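/- Notation and conventions. For $\beta\in\mathbb N^n$ put $|\beta|=\beta_1+\dots+\beta_n$ and $z^\beta=z_1^{\beta_1}\cdots z_n^{\beta_n}$; let $\mathbb D^n(0,\rho)=\{z\in\mathbb C^n: |z_1|<\rho,\dots,|z_n|<\rho\}$ and $\mathbb D^n=\mathbb D^n(0,1)$. The monomials are enumerated as $e_k(z)=z^{\alpha(k)}$, $k\ge 0$, where $k<j$ if and only if $|\alpha(k)|<|\alpha(j)|$, or $|\alpha(k)|=|\alpha(j)|$ and $\alpha_s(k)>\alpha_s(j)$ for the smallest $s$ with $\alpha_s(k)\ne\alpha_s(j)$; thus $e_0=1$. For a holomorphic vector field $G$ near $0\in\mathbb C^n$, the Koopman generator is $L_Gf=G\cdot\nabla f$, and $\langle L_Ge_k,e_j\rangle$ denotes the coefficient of $z^{\alpha(j)}$ in the Taylor series of $L_Ge_k$ at $0$ (the Hardy-space inner product when $L_Ge_k\in\mathbb H^2(\mathbb D^n)$). $JG(0)$ is the Jacobian matrix of $G$ at $0$. A commutation law is a map $\sigma:[0,\infty)\to\{1,\dots,m\}$ with finitely many discontinuities on every bounded interval. A trajectory of the switched system $\{\dot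 z=F^{(i)}(z)\}_{i=1}^m$ on $\mathbb D^n$ for $\sigma$ is a continuous $z:[0,\infty)\to\mathbb D^n$ with $\dot z(t)=F^{(\sigma(t))}(z(t))$ at every $t>0$ at which $\sigma$ is continuous. If $F^{(i)}(0)=0$ for all $i$, the switched system is GUAS (globally uniformly asymptotically stable) on $D\subseteq\mathbb D^n$ if (a) for every $\epsilon>0$ there is $\delta>0$ such that for all $\sigma$ and all trajectories with $\|z(0)\|\le\delta$ one has $\|z(t)\|\le\epsilon$ for all $t>0$ and $\lim_{t\to\infty}z(t)=0$; and (b) for all $\sigma$ and all trajectories with $z(0)\in D$, $\lim_{t\to\infty}z(t)=0$. Statement. Let $F^{(1)},\dots,F^{(m)}$ be vector fields on $\mathbb D^n$ whose components are given on $\mathbb D^n$ by power series with absolutely summable coefficients: $F^{(i)}_l(z)=\sum_{k}a^{(i)}_{l,k}z^{\alpha(k)}$ with $\sum_k|a^{(i)}_{l,k}|<\infty$. Assume that: 1. each $F^{(i)}$ generates a holomorphic flow $\varphi^{(i)}_t:\mathbb D^n\to\mathbb D^n$, $t\ge0$; $F^{(i)}(0)=0$; all eigenvalues of $JF^{(i)}(0)$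 have negative real part; and $0$ is globally asymptotically stable on $\mathbb D^n$ for each $\varphi^{(i)}$ (it is stable, and $\varphi_t^{(i)}(z)\to0$ as $t\to\infty$ for every $z\in\mathbb D^n$); 2. the Lie algebra of matrices generated by $JF^{(1)}(0),\dots,JF^{(m)}(0)$ is solvable; $P$ is an invertible complex matrix such that all $P^{-1}JF^{(i)}(0)P$ are upper triangular, normalized by $\|P^{-1}\|_\infty=1$ (operator norm for the maximum norm of $\mathbb C^n$); and $\widehat F^{(i)}(\widehat z)=P^{-1}F^{(i)}(P\widehat z)$, a holomorphic vector field near $0$; 3. $\rho\in\,]0,1]$ and $\varphi^{(i)}_t(\mathbb D^n(0,\rho))\subseteq\mathbb D^n(0,\rho)$ for all $i$ and $t\ge 0$. Suppose that there are $\xi,\kappa\in\,]0,1[$ with $\xi+\kappa<1$ such that, for all $i$ and all $q<r$ in $\{1,\dots,n\}$, $$\left|[J\widehat F^{(i)}(0)]_{qr}\right|^2<\left(\frac{2\xi}{n^2-n}\right)^2\left|\Re[J\widehat F^{(i)}(0)]_{rr}\right|\left|\Re[J\widehat F^{(i)}(0)]_{qq}\right|,$$ $$\left|[J\widehat F^{(i)}(0)]_{qr}\right|<\frac{2\xi}{n^2-n}\left|\Re[J\widehat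 F^{(i)}(0)]_{qq}\right|,$$ and $$\max_{i=1,\dots,m}\ \limsup_{j\to\infty}\ \max_{\substack{1\le k\le j-1\\ \langle L_{\widehat F^{(i)}}e_k,e_j\rangle\ne0}}\ \frac{\sum_{l=1}^\infty\left|\langle L_{\widehat F^{(i)}}e_l,e_j\rangle\right|\ \sum_{l=1}^\infty\left|\langle L_{\widehat F^{(i)}}e_k,e_l\rangle\right|}{\kappa^2\left|\Re\langle L_{\widehat F^{(i)}}e_j,e_j\rangle\right|\left|\Re\langle L_{\widehat F^{(i)}}e_k,e_k\rangle\right|}<\frac1{\rho^2},$$ where the sums take values in $[0,\infty]$ and a maximum over the empty set is $0$. Then the switched system $\{\dot z=F^{(i)}(z)\}_{i=1}^m$ is GUAS on $\mathbb D^n(0,\rho)$. -/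

import Mathlib

open Filter Topology Set
open scoped ENNReal NNReal

noncomputable section

namespace SwitchedKoopman

/-! ### Switched systems and stability -/

section Switched

variable {m : ℕ} {E : Type*} [NormedAddCommGroup E] [NormedSpace ℝ E]

/-- A commutation law: a map `σ : [0, ∞) → {1, …, m}` (the values at negative times are never used)
with finitely many discontinuities on every bounded time interval. As `Fin m` is discrete, `σ` is
constant between two consecutive discontinuities. -/
def IsCommutationLaw (σ : ℝ → Fin m) : Prop :=
  ∀ T : ℝ, {t : ℝ | 0 < t ∧ t ≤ T ∧ ¬ ContinuousAt σ t}.Finite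

/-- `x` is a solution on `[0, ∞)` of the switched system `ẋ = F^{(σ)}(x)` with state space `X`:
it is continuous, stays in `X`, and satisfies the differential equation off the switching times. -/
structure IsTrajectory (F : Fin m → E → E) (X : Set E) (σ : ℝ → Fin m) (x : ℝ → E) : Prop where
  continuousOn : ContinuousOn x (Ici 0)
  mem : ∀ t, 0 ≤ t → x t ∈ X
  hasDerivAt : ∀ t, 0 < t → ContinuousAt σ t → HasDerivAt x (F (σ t) (x t)) t

/-- Uniform asymptotic stability of the common equilibrium `xe` of a switched system on `X`. -/
def IsUAS (F : Fin m → E → E) (X : Set E) (xe : E) : Prop :=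
  (∀ i, F i xe = 0) ∧
  ∀ ε : ℝ, 0 < ε → ∃ δ : ℝ, 0 < δ ∧
    (∀ σ x, IsCommutationLaw σ → IsTrajectory F X σ x → ‖x 0 - xe‖ ≤ δ →
      ∀ t, 0 < t → ‖x t - xe‖ ≤ ε) ∧
    (∀ σ x, IsCommutationLaw σ → IsTrajectory F X σ x → ‖x 0 - xe‖ ≤ δ →
      Tendsto x atTop (𝓝 xe))

/-- Global uniform asymptotic stability on `D` of the common equilibrium `xe` of a switched
system on `X`. -/
def IsGUAS (F : Fin m → E → E) (X : Set E) (xe : E) (D : Set E) : Prop :=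
  IsUAS F X xe ∧
  ∀ σ x, IsCommutationLaw σ → IsTrajectory F X σ x → x 0 ∈ D → Tendsto x atTop (𝓝 xe)

/-- The point `xe` is a globally asymptotically stable equilibrium, on the state space `X`, of the
single (non-switched) system with flow `φ`. -/
def IsGloballyAsymptoticallyStable (φ : ℝ → E → E) (X : Set E) (xe : E) : Prop :=
  (∀ ε : ℝ, 0 < ε → ∃ δ : ℝ, 0 < δ ∧
    ∀ z ∈ X, ‖z - xe‖ ≤ δ → ∀ t, 0 ≤ t → ‖φ t z - xe‖ ≤ ε) ∧
  ∀ z ∈ X, Tendsto (fun t => φ t z) atTop (𝓝 xe)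

end Switched

/-! ### Vector fields on the polydisk -/

variable {n : ℕ}

/-- The open polydisk of `ℂⁿ` centred at `0` with radius `ρ`. -/
def polydisk (n : ℕ) (ρ : ℝ) : Set (Fin n → ℂ) := {z | ∀ l, ‖z l‖ < ρ}

/-- `φ` is the forward flow on `X` of the vector field `F`, and it is holomorphic. -/
structure IsHolomorphicFlow (F : (Fin n → ℂ) → (Fin n → ℂ)) (X : Set (Fin n → ℂ))
    (φ : ℝ → (Fin n → ℂ) → (Fin n → ℂ)) : Prop where
  map_zero : ∀ z ∈ X, φ 0 z = z
  mapsTo : ∀ t, 0 ≤ t → MapsTo (φ t) X X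
  hasDerivWithinAt : ∀ z ∈ X, ∀ t, 0 ≤ t →
    HasDerivWithinAt (fun s => φ s z) (F (φ t z)) (Ici 0) t
  differentiableOn : ∀ t, 0 ≤ t → DifferentiableOn ℂ (φ t) X

/-- The Jacobian matrix of `F` at `z`. -/
def jacobian (F : (Fin n → ℂ) → (Fin n → ℂ)) (z : Fin n → ℂ) : Matrix (Fin n) (Fin n) ℂ :=
  LinearMap.toMatrix' (fderiv ℂ F z : (Fin n → ℂ) →ₗ[ℂ] (Fin n → ℂ))

/-- `0` is an equilibrium of `F` whose Jacobian matrix has only eigenvalues with negative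
real part. -/
def IsHyperbolicStableAtZero (F : (Fin n → ℂ) → (Fin n → ℂ)) : Prop :=
  F 0 = 0 ∧ ∀ μ ∈ spectrum ℂ (jacobian F 0), μ.re < 0

section LieSpan

attribute [local instance] LieRing.ofAssociativeRing

/-- The complex Lie algebra generated by the set `S` of matrices, with bracket `AB - BA`, is
solvable. -/
def HasSolvableLieSpan (S : Set (Matrix (Fin n) (Fin n) ℂ)) : Prop :=
  LieAlgebra.IsSolvable (LieSubalgebra.lieSpan ℂ (Matrix (Fin n) (Fin n) ℂ) S)

end LieSpan

/-- The vector field in the coordinates `w = P⁻¹ z`, i.e. `w ↦ P⁻¹ F(P w)`. -/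
def changeCoord (P : Matrix (Fin n) (Fin n) ℂ) (F : (Fin n → ℂ) → (Fin n → ℂ)) :
    (Fin n → ℂ) → (Fin n → ℂ) :=
  fun w => P⁻¹.mulVec (F (P.mulVec w))

/-- The operator norm of a matrix for the maximum norm of `ℂⁿ` (largest absolute row sum). -/
def infNorm (A : Matrix (Fin n) (Fin n) ℂ) : ℝ≥0 :=
  Finset.univ.sup fun i => ∑ j, ‖A i j‖₊

/-! ### Monomials and Taylor coefficients -/

/-- The monomial `z ↦ z^β`. -/
def mono (β : Fin n → ℕ) : (Fin n → ℂ) → ℂ := fun z => ∏ l, z l ^ β l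

/-- The function `f` is given on the unit polydisk by a power series with absolutely summable
coefficients. -/
def HasSummableTaylor (f : (Fin n → ℂ) → ℂ) : Prop :=
  ∃ a : (Fin n → ℕ) → ℂ, Summable (fun β => ‖a β‖) ∧
    ∀ z ∈ polydisk n 1, HasSum (fun β => a β * mono β z) (f z)

/-- The strict order used to enumerate the monomials: by total degree first; among monomials of
the same degree, the one with the larger exponent at the first difference comes first. -/
def MonoLT (β γ : Fin n → ℕ) : Prop :=
  ∑ l, β l < ∑ l, γ l ∨
    (∑ l, β l = ∑ l, γ l ∧ ∃ j, (∀ i, i < j → β i = γ i) ∧ γ j < β j)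

/-- The partial derivative `∂f/∂z_l`. -/
def partialDeriv (l : Fin n) (f : (Fin n → ℂ) → ℂ) : (Fin n → ℂ) → ℂ :=
  fun z => fderiv ℂ f z (Pi.single l 1)

/-- The mixed partial derivative `∂^β f`. -/
def multiDeriv (β : Fin n → ℕ) (f : (Fin n → ℂ) → ℂ) : (Fin n → ℂ) → ℂ :=
  (List.finRange n).foldr (fun l g => (partialDeriv l)^[β l] g) f

/-- The coefficient `∂^β f(0) / β!` of `z^β` in the Taylor series at `0` of a function that is
holomorphic near `0`. If `f` lies in the Hardy space of the unit polydisk, it is the inner product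
of `f` with the monomial `z^β`. -/
def taylorCoeff (f : (Fin n → ℂ) → ℂ) (β : Fin n → ℕ) : ℂ :=
  multiDeriv β f 0 / ((∏ l, (β l).factorial : ℕ) : ℂ)

/-! ### The Koopman generator and its matrix -/

/-- The Koopman generator `L_F f = F · ∇f`. -/
def koopmanGenerator (F : (Fin n → ℂ) → (Fin n → ℂ)) (f : (Fin n → ℂ) → ℂ) :
    (Fin n → ℂ) → ℂ :=
  fun z => fderiv ℂ f z (F z)

/-- The entry `⟨L_F z^β, z^γ⟩` (row `β`, column `γ`) of the Koopman matrix. -/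
def koopmanEntry (F : (Fin n → ℂ) → (Fin n → ℂ)) (β γ : Fin n → ℕ) : ℂ :=
  taylorCoeff (koopmanGenerator F (mono β)) γ

/-- The absolute sum of row `β` of the Koopman matrix, over the non-constant monomials; it may be
infinite. -/
def koopmanRowSum (F : (Fin n → ℂ) → (Fin n → ℂ)) (β : Fin n → ℕ) : ℝ≥0∞ :=
  ∑' γ : {γ : Fin n → ℕ // γ ≠ 0}, ‖koopmanEntry F β γ‖ₑ

/-- The absolute sum of column `γ` of the Koopman matrix, over the non-constant monomials. -/
def koopmanColSum (F : (Fin n → ℂ) → (Fin n → ℂ)) (γ : Fin n → ℕ) : ℝ≥0∞ :=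
  ∑' β : {β : Fin n → ℕ // β ≠ 0}, ‖koopmanEntry F β γ‖ₑ

/-- The quotient of the product (absolute sum of column `γ`) · (absolute sum of row `β`) by
`κ² |Re ⟨L_F z^γ, z^γ⟩| |Re ⟨L_F z^β, z^β⟩|`. -/
def koopmanRatio (κ : ℝ) (F : (Fin n → ℂ) → (Fin n → ℂ)) (β γ : Fin n → ℕ) : ℝ≥0∞ :=
  koopmanColSum F γ * koopmanRowSum F β /
    ENNReal.ofReal (κ ^ 2 * |(koopmanEntry F γ γ).re| * |(koopmanEntry F β β).re|)

/-- The limit superior over the monomials `z^γ` of the maximum of `koopmanRatio κ F β γ` over the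
non-constant `z^β` preceding `z^γ` with `⟨L_F z^β, z^γ⟩ ≠ 0` (the maximum is `0` if there is none).
A limit superior along an enumeration by `ℕ` is one along the cofinite filter. -/
def koopmanLimsup (κ : ℝ) (F : (Fin n → ℂ) → (Fin n → ℂ)) : ℝ≥0∞ :=
  limsup (fun γ : Fin n → ℕ =>
    ⨆ (β : Fin n → ℕ) (_ : β ≠ 0) (_ : MonoLT β γ) (_ : koopmanEntry F β γ ≠ 0),
      koopmanRatio κ F β γ) cofinite

end SwitchedKoopman

end

open SwitchedKoopman

open SwitchedKoopman
open scoped ComplexConjugate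

/-! In the coordinates w = P⁻¹z the function V = ∑_β ε_{|β|} |w^β|² is a common Lyapunov function
for suitable weights ε. Along ẇ = G(w) the derivative of |w^β|² is 2 Re(conj(w^β) · L_G w^β), so V'
is a quadratic form in the numbers w^β, governed by the Koopman matrix. Put D_β = ∑ β_l |Re J_ll|,
with J the triangular Jacobian, and Y = ∑ ε_{|β|} D_β |w^β|². Since G(0) = 0 and J is upper
triangular, three kinds of entries remain.

The diagonal contributes -2Y. The off-diagonal entries between monomials of equal degree contribute
at most 2ξY: each of the n(n-1)/2 positions above the diagonal of J is absorbed by the inequality of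
arithmetic and geometric means (`tsum_linear_entry_le`). The entries that raise the degree
contribute at most 2κY by a Schur test with row sums R and column sums C (`schur_test`), provided
ε_{|β|} R_β C_γ ≤ κ² D_β D_γ ε_{|γ|}. The limsup condition allows weights growing like ρ⁻² per
degree, up to a constant for the finitely many low degrees (`exists_weights`), and this is a growth
for which V converges on ‖w‖ < ρ. Hence V' ≤ -2(1-ξ-κ)Y ≤ -cV (`lyapunov_deriv_le`), while V ≥
ε₁‖w‖², and trajectories decay exponentially (`isGUAS_of_lyapunov`).

Three points make this rigorous. V is a holomorphic power series U evaluated at the squared moduli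
|w_l|², so it can be differentiated term by term. The limsup condition forces the Taylor
coefficients of G to be absolutely summable (`tsum_enorm_coeff_ne_top`), and the identity theorem
equates G with its series where w and Pw both lie in the unit polydisk. Between switching times a
trajectory follows one flow, so it stays in the ρ-polydisk, and ‖P⁻¹‖ = 1 keeps w there too. -/

section SingleField

variable {n : ℕ}

/-! ### Monomial power series on polydisks. -/

/-- The total degree of a multi-index. -/
abbrev deg (β : Fin n → ℕ) : ℕ := ∑ l, β l

/-- `f` is the sum of the power series with coefficients `a` on the open polydisk of radius `s`. -/
def HasMonoSeries (s : ℝ) (f : (Fin n → ℂ) → ℂ) (a : (Fin n → ℕ) → ℂ) : Prop :=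
  ∀ w ∈ Metric.ball (0 : Fin n → ℂ) s, HasSum (fun β => a β * mono β w) (f w)

theorem polydisk_eq_ball {s : ℝ} (hs : 0 < s) : polydisk n s = Metric.ball 0 s := by
  ext z
  simp [polydisk, pi_norm_lt_iff hs]

theorem norm_mono (β : Fin n → ℕ) (w : Fin n → ℂ) : ‖mono β w‖ = ∏ l, ‖w l‖ ^ β l := by
  simp [mono, norm_prod]

theorem norm_mono_le (β : Fin n → ℕ) {w : Fin n → ℂ} {s : ℝ} (hw : ‖w‖ ≤ s) :
    ‖mono β w‖ ≤ s ^ deg β := by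
  rw [norm_mono, ← Finset.prod_pow_eq_pow_sum]
  exact Finset.prod_le_prod (fun _ _ => by positivity)
    fun l _ => pow_le_pow_left₀ (norm_nonneg _) ((norm_le_pi_norm w l).trans hw) _

theorem mono_const (β : Fin n → ℕ) (t : ℂ) : mono β (fun _ => t) = t ^ deg β := by
  simp [mono, Finset.prod_pow_eq_pow_sum]

theorem mono_add (β γ : Fin n → ℕ) (w : Fin n → ℂ) : mono (β + γ) w = mono β w * mono γ w := by
  simp [mono, pow_add, Finset.prod_mul_distrib]

@[simp] theorem mono_zero (w : Fin n → ℂ) : mono 0 w = 1 := by simp [mono]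

@[simp] theorem mono_single (l : Fin n) (w : Fin n → ℂ) : mono (Pi.single l 1) w = w l := by
  rw [mono, Finset.prod_eq_single l] <;> simp +contextual

theorem deg_add (β γ : Fin n → ℕ) : deg (β + γ) = deg β + deg γ := by
  simp [deg, Finset.sum_add_distrib]

@[simp] theorem deg_single (l : Fin n) : deg (Pi.single l 1) = 1 := by
  simp [deg]

theorem sub_single_add {β : Fin n → ℕ} {l : Fin n} (h : β l ≠ 0) :
    β - Pi.single l 1 + Pi.single l 1 = β := by
  funext j
  by_cases hj : j = l
  · subst hj; simp; omega
  · simp [hj]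

theorem HasMonoSeries.summable_norm_mul_pow {s t : ℝ} {f : (Fin n → ℂ) → ℂ}
    {a : (Fin n → ℕ) → ℂ} (h : HasMonoSeries s f a) (ht : 0 ≤ t) (hts : t < s) :
    Summable fun β => ‖a β‖ * t ^ deg β := by
  have hw : (fun _ => (t : ℂ)) ∈ Metric.ball (0 : Fin n → ℂ) s := by
    rw [mem_ball_zero_iff, pi_norm_lt_iff (ht.trans_lt hts)]
    intro _
    simpa [abs_of_nonneg ht] using hts
  refine (h _ hw).summable.norm.congr fun β => ?_
  rw [mono_const, norm_mul, norm_pow, Complex.norm_real, Real.norm_of_nonneg ht]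

/-- The derivative of the monomial `z^β` at `w`. -/
noncomputable def monoDeriv (β : Fin n → ℕ) (w : Fin n → ℂ) : (Fin n → ℂ) →L[ℂ] ℂ :=
  ∑ l, ((β l : ℂ) * mono (β - Pi.single l 1) w) •
    (ContinuousLinearMap.proj l : (Fin n → ℂ) →L[ℂ] ℂ)

theorem monoDeriv_apply (β : Fin n → ℕ) (w v : Fin n → ℂ) :
    monoDeriv β w v = ∑ l, (β l : ℂ) * mono (β - Pi.single l 1) w * v l := by
  simp [monoDeriv]

theorem hasFDerivAt_mono (β : Fin n → ℕ) (w : Fin n → ℂ) :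
    HasFDerivAt (mono β) (monoDeriv β w) w := by
  have h := HasFDerivAt.finsetProd (u := Finset.univ) (x := w)
    (g := fun l (z : Fin n → ℂ) => z l ^ β l)
    (fun l _ => ((ContinuousLinearMap.proj l : (Fin n → ℂ) →L[ℂ] ℂ).hasFDerivAt (x := w)).pow (β l))
  refine h.congr_fderiv ?_
  rw [monoDeriv]
  refine Finset.sum_congr rfl fun l _ => ?_
  rw [smul_smul]
  congr 1
  symm
  rw [mono, ← Finset.mul_prod_erase _ _ (Finset.mem_univ l)]
  have : ∏ x ∈ Finset.univ.erase l, w x ^ (β - Pi.single l 1 : Fin n → ℕ) x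
      = ∏ x ∈ Finset.univ.erase l, w x ^ β x :=
    Finset.prod_congr rfl fun x hx => by simp [Finset.ne_of_mem_erase hx]
  rw [this]
  simp
  ring

theorem norm_monoDeriv_le (β : Fin n → ℕ) {w : Fin n → ℂ} {s : ℝ} (hw : ‖w‖ ≤ s) :
    ‖monoDeriv β w‖ ≤ deg β * s ^ (deg β - 1) := by
  have hs : 0 ≤ s := (norm_nonneg _).trans hw
  refine ContinuousLinearMap.opNorm_le_bound _ (by positivity) fun v => ?_
  rw [monoDeriv_apply, deg, Nat.cast_sum, Finset.sum_mul, Finset.sum_mul]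
  refine norm_sum_le_of_le _ fun l _ => ?_
  rw [norm_mul, norm_mul, Complex.norm_natCast]
  by_cases hl : β l = 0
  · simp [hl]
  · have h1 : deg (β - Pi.single l 1) = deg β - 1 := by
      conv_rhs => rw [← sub_single_add hl, deg_add, deg_single]
      omega
    have := norm_mono_le (β - Pi.single l 1) hw
    rw [h1] at this
    have h2 := norm_le_pi_norm v l
    gcongr

/-- Tangent-line inequality for the convex function `x ^ k`. It trades the factor `k` of a
differentiated series for a slightly larger radius, at the cost of the constant `(y - x)⁻¹`. -/
theorem mul_pow_mul_sub_le {x y : ℝ} (hx : 0 ≤ x) (hxy : x ≤ y) (k : ℕ) :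
    k * x ^ (k - 1) * (y - x) ≤ y ^ k := by
  suffices h : x ^ k + k * x ^ (k - 1) * (y - x) ≤ y ^ k by
    have := pow_nonneg hx k
    linarith
  induction k with
  | zero => simp
  | succ k ih =>
    have h1 : (k : ℝ) * x ^ (k - 1) * x = k * x ^ k := by
      rcases k with _ | k
      · simp
      · rw [Nat.add_sub_cancel, pow_succ]; ring
    have hp : 0 ≤ (k : ℝ) * x ^ (k - 1) := by positivity
    calc x ^ (k + 1) + ((k + 1 : ℕ) : ℝ) * x ^ (k + 1 - 1) * (y - x)
        = x ^ k * y + (k * x ^ k) * (y - x) := by rw [Nat.add_sub_cancel]; push_cast; ring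
      _ ≤ (x ^ k + k * x ^ (k - 1) * (y - x)) * y := by
          rw [← h1]
          nlinarith [mul_nonneg hp (mul_self_nonneg (y - x))]
      _ ≤ y ^ k * y := by gcongr; linarith
      _ = _ := by ring

/-- A monomial series may be differentiated term by term. -/
theorem HasMonoSeries.hasFDerivAt {s t : ℝ} {f : (Fin n → ℂ) → ℂ} {a : (Fin n → ℕ) → ℂ}
    (h : HasMonoSeries s f a) (hts : t < s) :
    ∃ C : ℝ≥0, ∀ w ∈ Metric.ball (0 : Fin n → ℂ) t, ∃ f' : (Fin n → ℂ) →L[ℂ] ℂ,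
      HasFDerivAt f f' w ∧ ‖f'‖₊ ≤ C ∧ ∀ v, HasSum (fun β => a β * monoDeriv β w v) (f' v) := by
  rcases le_or_gt t 0 with ht | ht
  · exact ⟨0, fun w hw => by simp [Metric.ball_eq_empty.2 ht] at hw⟩
  obtain ⟨r, htr, hrs⟩ := exists_between hts
  have hu : Summable fun β => ‖a β‖ * (deg β * t ^ (deg β - 1)) := by
    refine Summable.of_nonneg_of_le (fun β => by positivity) (fun β => ?_)
      ((h.summable_norm_mul_pow (ht.le.trans htr.le) hrs).mul_right (r - t)⁻¹)
    rw [mul_assoc]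
    refine mul_le_mul_of_nonneg_left ?_ (norm_nonneg _)
    rw [← div_eq_mul_inv, le_div_iff₀ (by linarith)]
    exact mul_pow_mul_sub_le ht.le htr.le _
  have hb : ∀ β, ∀ w ∈ Metric.ball (0 : Fin n → ℂ) t,
      ‖a β • monoDeriv β w‖ ≤ ‖a β‖ * (deg β * t ^ (deg β - 1)) := fun β w hw => by
    rw [norm_smul]
    gcongr
    exact norm_monoDeriv_le β (mem_ball_zero_iff.1 hw).le
  refine ⟨(∑' β, ‖a β‖ * (deg β * t ^ (deg β - 1))).toNNReal, fun w hw =>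
    ⟨∑' β, a β • monoDeriv β w, ?_, ?_, fun v => ?_⟩⟩
  · have h0 : (0 : Fin n → ℂ) ∈ Metric.ball (0 : Fin n → ℂ) t := Metric.mem_ball_self ht
    have := hasFDerivAt_tsum_of_isPreconnected hu Metric.isOpen_ball
      (convex_ball (0 : Fin n → ℂ) t).isPreconnected
      (f := fun β w => a β * mono β w)
      (fun β w _ => (hasFDerivAt_mono β w).const_mul (a β)) hb h0
      (h _ (Metric.ball_subset_ball hts.le h0)).summable hw
    refine this.congr_of_eventuallyEq ?_
    filter_upwards [Metric.isOpen_ball.mem_nhds hw] with z hz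
    exact (h z (Metric.ball_subset_ball hts.le hz)).tsum_eq.symm
  · rw [← NNReal.coe_le_coe, coe_nnnorm, Real.coe_toNNReal _ (tsum_nonneg fun β => by positivity)]
    exact tsum_of_norm_bounded hu.hasSum fun β => hb β w hw
  · have hs : Summable fun β => a β • monoDeriv β w :=
      Summable.of_norm_bounded hu fun β => hb β w hw
    simpa using hs.hasSum.mapL (ContinuousLinearMap.apply ℂ ℂ v)

theorem HasMonoSeries.hasFDerivAt_of_mem {s : ℝ} {f : (Fin n → ℂ) → ℂ} {a : (Fin n → ℕ) → ℂ}
    (h : HasMonoSeries s f a) {w : Fin n → ℂ} (hw : w ∈ Metric.ball (0 : Fin n → ℂ) s) :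
    ∃ f' : (Fin n → ℂ) →L[ℂ] ℂ,
      HasFDerivAt f f' w ∧ ∀ v, HasSum (fun β => a β * monoDeriv β w v) (f' v) := by
  obtain ⟨t, hwt, hts⟩ := exists_between (mem_ball_zero_iff.1 hw)
  obtain ⟨C, hC⟩ := h.hasFDerivAt hts
  obtain ⟨f', h1, -, h2⟩ := hC w (mem_ball_zero_iff.2 hwt)
  exact ⟨f', h1, h2⟩

theorem HasMonoSeries.differentiableAt {s : ℝ} {f : (Fin n → ℂ) → ℂ} {a : (Fin n → ℕ) → ℂ}
    (h : HasMonoSeries s f a) {w : Fin n → ℂ} (hw : w ∈ Metric.ball (0 : Fin n → ℂ) s) :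
    DifferentiableAt ℂ f w :=
  let ⟨_, h1, _⟩ := h.hasFDerivAt_of_mem hw
  h1.differentiableAt

theorem HasMonoSeries.apply_zero {s : ℝ} (hs : 0 < s) {f : (Fin n → ℂ) → ℂ}
    {a : (Fin n → ℕ) → ℂ} (h : HasMonoSeries s f a) : f 0 = a 0 := by
  refine (h 0 (Metric.mem_ball_self hs)).unique ?_
  convert hasSum_single (0 : Fin n → ℕ) ?_ using 1
  · simp
  · intro β hβ
    obtain ⟨l, hl⟩ := Function.ne_iff.1 hβ
    rw [mono, Finset.prod_eq_zero (Finset.mem_univ l) (by simpa using hl), mul_zero]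

/-! ### Partial derivatives and Taylor coefficients. -/

theorem HasMonoSeries.partialDeriv {s : ℝ} {f : (Fin n → ℂ) → ℂ} {a : (Fin n → ℕ) → ℂ}
    (h : HasMonoSeries s f a) (l : Fin n) :
    HasMonoSeries s (partialDeriv l f) fun β => ((β l : ℂ) + 1) * a (β + Pi.single l 1) := by
  intro w hw
  obtain ⟨f', h1, h2⟩ := h.hasFDerivAt_of_mem hw
  have h3 := h2 (Pi.single l 1)
  rw [SwitchedKoopman.partialDeriv, h1.fderiv]
  have hinj : Function.Injective fun β : Fin n → ℕ => β + Pi.single l 1 :=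
    add_left_injective _
  rw [← hinj.hasSum_iff] at h3
  · convert h3 using 2 with β
    simp only [Function.comp, monoDeriv_apply]
    rw [Finset.sum_eq_single l]
    · simp
      ring
    · intro j _ hj
      simp [hj]
    · simp
  · intro β hβ
    have : β l = 0 := by
      by_contra hne
      exact hβ ⟨β - Pi.single l 1, sub_single_add hne⟩
    rw [monoDeriv_apply, Finset.sum_eq_zero, mul_zero]
    intro j _
    by_cases hj : j = l
    · subst hj; simp [this]
    · simp [hj]

theorem prod_factorial_add_single (β : Fin n → ℕ) (l : Fin n) :
    ∏ j, ((β + Pi.single l 1 : Fin n → ℕ) j).factorial = (β l + 1) * ∏ j, (β j).factorial := by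
  rw [← Finset.mul_prod_erase _ _ (Finset.mem_univ l),
    ← Finset.mul_prod_erase Finset.univ (fun j => (β j).factorial) (Finset.mem_univ l), ← mul_assoc]
  congr 1
  · simp [Nat.factorial_succ]
  · exact Finset.prod_congr rfl fun x hx => by simp [Finset.ne_of_mem_erase hx]

/-- With coefficients normalized as `c β / β!`, differentiation in one variable is a mere shift of
`c`, so that iteration is immediate. -/
theorem HasMonoSeries.partialDeriv_factorial {s : ℝ} {f : (Fin n → ℂ) → ℂ}
    {c : (Fin n → ℕ) → ℂ}
    (h : HasMonoSeries s f fun β => c β / ((∏ l, (β l).factorial : ℕ) : ℂ)) (l : Fin n) (k : ℕ) :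
    HasMonoSeries s ((SwitchedKoopman.partialDeriv l)^[k] f)
      fun β => c (β + k • Pi.single l 1) / ((∏ l, (β l).factorial : ℕ) : ℂ) := by
  induction k with
  | zero => simpa using h
  | succ k ih =>
    rw [Function.iterate_succ', Function.comp]
    convert ih.partialDeriv l using 2 with β
    rw [prod_factorial_add_single, add_smul, one_smul, add_assoc,
      add_comm (k • Pi.single l 1 : Fin n → ℕ)]
    have : ((β l : ℂ) + 1) ≠ 0 := Nat.cast_add_one_ne_zero _
    push_cast
    field_simp

/-- The Taylor coefficients of the sum of a monomial series. -/
theorem HasMonoSeries.taylorCoeff_eq {s : ℝ} (hs : 0 < s) {f : (Fin n → ℂ) → ℂ}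
    {a : (Fin n → ℕ) → ℂ} (h : HasMonoSeries s f a) (β : Fin n → ℕ) : taylorCoeff f β = a β := by
  have hne : ∀ β : Fin n → ℕ, ((∏ l, (β l).factorial : ℕ) : ℂ) ≠ 0 := fun β => by
    exact_mod_cast (Finset.prod_pos fun l _ => Nat.factorial_pos _).ne'
  obtain ⟨c, hc⟩ : ∃ c : (Fin n → ℕ) → ℂ,
      c = fun β => a β * ((∏ l, (β l).factorial : ℕ) : ℂ) := ⟨_, rfl⟩
  have h' : HasMonoSeries s f fun β => c β / ((∏ l, (β l).factorial : ℕ) : ℂ) := by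
    convert h using 2 with β
    rw [hc]
    exact mul_div_cancel_right₀ _ (hne β)
  -- The variables are processed one at a time. Over the full list the shifts add up to `β`, and the
  -- value at `0` reads off `c β`.
  have key : ∀ L : List (Fin n), HasMonoSeries s
      (L.foldr (fun l g => (SwitchedKoopman.partialDeriv l)^[β l] g) f)
      fun γ => c (γ + (L.map fun l => β l • (Pi.single l 1 : Fin n → ℕ)).sum) /
        ((∏ l, (γ l).factorial : ℕ) : ℂ) := by
    intro L
    induction L with
    | nil => simpa using h'
    | cons l L ih =>
      have := HasMonoSeries.partialDeriv_factorial
        (c := fun γ => c (γ + (L.map fun l => β l • (Pi.single l 1 : Fin n → ℕ)).sum)) ih l (β l)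
      simpa [add_assoc] using this
  have h0 := (key (List.finRange n)).apply_zero hs
  have hsum : ((List.finRange n).map fun l => β l • (Pi.single l 1 : Fin n → ℕ)).sum = β := by
    rw [← List.ofFn_eq_map, List.sum_ofFn]
    funext j
    simp [Finset.sum_apply, Pi.single_apply]
  rw [hsum] at h0
  rw [taylorCoeff, multiDeriv, h0]
  rw [hc, zero_add]
  simpa using mul_div_cancel_right₀ (a β) (hne β)

theorem HasMonoSeries.coeff_single {s : ℝ} (hs : 0 < s) {f : (Fin n → ℂ) → ℂ}
    {a : (Fin n → ℕ) → ℂ} (h : HasMonoSeries s f a) (l : Fin n) :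
    fderiv ℂ f 0 (Pi.single l 1) = a (Pi.single l 1) := by
  simpa [SwitchedKoopman.partialDeriv] using (h.partialDeriv l).apply_zero hs

theorem HasMonoSeries.congr {s : ℝ} {f g : (Fin n → ℂ) → ℂ} {a : (Fin n → ℕ) → ℂ}
    (h : HasMonoSeries s f a) (hfg : ∀ w ∈ Metric.ball (0 : Fin n → ℂ) s, f w = g w) :
    HasMonoSeries s g a := fun w hw => hfg w hw ▸ h w hw

theorem HasMonoSeries.mono_radius {s t : ℝ} {f : (Fin n → ℂ) → ℂ} {a : (Fin n → ℕ) → ℂ}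
    (h : HasMonoSeries s f a) (hts : t ≤ s) : HasMonoSeries t f a :=
  fun w hw => h w (Metric.ball_subset_ball hts hw)

theorem HasMonoSeries.const_mul {s : ℝ} {f : (Fin n → ℂ) → ℂ} {a : (Fin n → ℕ) → ℂ}
    (h : HasMonoSeries s f a) (c : ℂ) :
    HasMonoSeries s (fun w => c * f w) fun β => c * a β := fun w hw => by
  simpa [mul_assoc] using (h w hw).mul_left c

theorem HasMonoSeries.sum {ι : Type*} {s : ℝ} {f : ι → (Fin n → ℂ) → ℂ}
    {a : ι → (Fin n → ℕ) → ℂ} (S : Finset ι) (h : ∀ k ∈ S, HasMonoSeries s (f k) (a k)) :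
    HasMonoSeries s (fun w => ∑ k ∈ S, f k w) fun β => ∑ k ∈ S, a k β := fun w hw => by
  simpa [Finset.sum_mul] using hasSum_sum fun k hk => h k hk w hw

/-! ### Multiplication by monomials and linear substitution. -/

open Classical in
/-- The coefficients of `z^δ` times the power series with coefficients `a`. -/
noncomputable def shiftCoeff (δ : Fin n → ℕ) (a : (Fin n → ℕ) → ℂ) (γ : Fin n → ℕ) : ℂ :=
  if δ ≤ γ then a (γ - δ) else 0

theorem shiftCoeff_add (δ : Fin n → ℕ) (a : (Fin n → ℕ) → ℂ) (η : Fin n → ℕ) :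
    shiftCoeff δ a (η + δ) = a η := by
  rw [shiftCoeff, if_pos (by simp), add_tsub_cancel_right]

theorem shiftCoeff_of_notMem {δ γ : Fin n → ℕ} (a : (Fin n → ℕ) → ℂ)
    (h : γ ∉ Set.range fun η => η + δ) : shiftCoeff δ a γ = 0 :=
  if_neg fun hle => h ⟨γ - δ, tsub_add_cancel_of_le hle⟩

theorem HasMonoSeries.mono_mul {s : ℝ} {f : (Fin n → ℂ) → ℂ} {a : (Fin n → ℕ) → ℂ}
    (h : HasMonoSeries s f a) (δ : Fin n → ℕ) :
    HasMonoSeries s (fun w => mono δ w * f w) (shiftCoeff δ a) := fun w hw => by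
  rw [← (add_left_injective δ).hasSum_iff]
  · refine ((h w hw).mul_left (mono δ w)).congr_fun fun η => ?_
    simp only [Function.comp, shiftCoeff_add, mono_add]
    ring
  · intro γ hγ
    rw [shiftCoeff_of_notMem a hγ, zero_mul]

theorem tsum_enorm_shiftCoeff_mul (δ : Fin n → ℕ) (a : (Fin n → ℕ) → ℂ)
    (g : (Fin n → ℕ) → ℝ≥0∞) :
    ∑' γ, ‖shiftCoeff δ a γ‖ₑ * g γ = ∑' η, ‖a η‖ₑ * g (η + δ) := by
  rw [← (add_left_injective δ).tsum_eq]
  · simp [shiftCoeff_add]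
  · intro γ hγ
    by_contra hc
    exact hγ (by simp [shiftCoeff_of_notMem a hc])

/-- `f` is the sum of a monomial series of weighted `ℓ¹` norm at most `A` on the polydisk of
radius `s`. -/
def MonoSeriesBound (s : ℝ≥0) (A : ℝ≥0∞) (f : (Fin n → ℂ) → ℂ) : Prop :=
  ∃ a, HasMonoSeries s f a ∧ ∑' β, ‖a β‖ₑ * (s : ℝ≥0∞) ^ deg β ≤ A

theorem monoSeriesBound_one (s : ℝ≥0) : MonoSeriesBound s 1 (fun _ : Fin n → ℂ => 1) := by
  refine ⟨Pi.single 0 1, fun w _ => ?_, ?_⟩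
  · convert hasSum_single (0 : Fin n → ℕ) ?_ using 1
    · simp
    · intro β hβ
      simp [hβ]
  · rw [tsum_eq_single 0]
    · simp [deg]
    · intro β hβ
      simp [hβ]

theorem MonoSeriesBound.linear_mul {s : ℝ≥0} {A : ℝ≥0∞} {f : (Fin n → ℂ) → ℂ}
    (h : MonoSeriesBound s A f) (p : Fin n → ℂ) :
    MonoSeriesBound s ((∑ k, ‖p k‖ₑ) * s * A) fun w => (∑ k, p k * w k) * f w := by
  obtain ⟨a, ha, hA⟩ := h
  refine ⟨fun γ => ∑ k, p k * shiftCoeff (Pi.single k 1) a γ, ?_, ?_⟩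
  · refine (HasMonoSeries.sum Finset.univ fun k _ =>
      (ha.mono_mul (Pi.single k 1)).const_mul (p k)).congr fun w _ => ?_
    simp [Finset.sum_mul, mul_assoc]
  · calc ∑' γ, ‖∑ k, p k * shiftCoeff (Pi.single k 1) a γ‖ₑ * (s : ℝ≥0∞) ^ deg γ
        ≤ ∑' γ, ∑ k, ‖p k‖ₑ * (‖shiftCoeff (Pi.single k 1) a γ‖ₑ * (s : ℝ≥0∞) ^ deg γ) := by
          refine ENNReal.tsum_le_tsum fun γ => ?_
          simp_rw [← mul_assoc, ← Finset.sum_mul, ← enorm_mul]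
          gcongr
          exact enorm_sum_le _ _
      _ = ∑ k, ‖p k‖ₑ * ∑' η, ‖a η‖ₑ * (s : ℝ≥0∞) ^ deg η * s := by
          rw [Summable.tsum_finsetSum fun _ _ => ENNReal.summable]
          refine Finset.sum_congr rfl fun k _ => ?_
          rw [ENNReal.tsum_mul_left, tsum_enorm_shiftCoeff_mul]
          simp_rw [deg_add, deg_single, pow_succ, mul_assoc]
      _ ≤ _ := by
          rw [ENNReal.tsum_mul_right, ← Finset.sum_mul, mul_assoc, mul_comm (s : ℝ≥0∞)]
          gcongr

/-- On so small a radius each linear factor has weighted ℓ¹ norm at most 1, and multiplying by it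
does not increase the bound. The bound is uniform in `δ`, so absolutely summable outer coefficients
suffice in `hasMonoSeries_of_hasSum`. -/
theorem monoSeriesBound_mono_comp {s : ℝ≥0} (P : Matrix (Fin n) (Fin n) ℂ)
    (hP : ∀ l, (∑ k, ‖P l k‖ₑ) * s ≤ 1) (δ : Fin n → ℕ) :
    MonoSeriesBound s 1 fun w => mono δ (P.mulVec w) := by
  have weaken : ∀ {A : ℝ≥0∞} {f : (Fin n → ℂ) → ℂ}, A ≤ 1 → MonoSeriesBound s A f →
      MonoSeriesBound s 1 f := fun hA ⟨a, h1, h2⟩ => ⟨a, h1, h2.trans hA⟩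
  have hpow : ∀ (l : Fin n) (k : ℕ) (f : (Fin n → ℂ) → ℂ), MonoSeriesBound s 1 f →
      MonoSeriesBound s 1 fun w => P.mulVec w l ^ k * f w := by
    intro l k f hf
    induction k with
    | zero => simpa using hf
    | succ k ih =>
      simp_rw [pow_succ', mul_assoc]
      exact weaken (by simpa using hP l) (ih.linear_mul (P l))
  have : ∀ S : Finset (Fin n),
      MonoSeriesBound s 1 fun w => ∏ l ∈ S, P.mulVec w l ^ δ l := by
    intro S
    induction S using Finset.induction_on with
    | empty => simpa using monoSeriesBound_one s
    | insert l S hl ih =>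
      simp_rw [Finset.prod_insert hl]
      exact hpow l _ _ ih
  exact this Finset.univ

theorem enorm_mono_le (β : Fin n → ℕ) {w : Fin n → ℂ} {s : ℝ≥0} (hw : ‖w‖ ≤ s) :
    ‖mono β w‖ₑ ≤ (s : ℝ≥0∞) ^ deg β := by
  have := norm_mono_le β hw
  rw [← ENNReal.coe_pow, enorm_eq_nnnorm, ENNReal.coe_le_coe, ← NNReal.coe_le_coe]
  simpa using this

/-- The double series over `(δ, β)` converges absolutely, because each inner series has weighted
norm at most 1; it may then be summed in the other order. -/
theorem hasMonoSeries_of_hasSum {ι : Type*} {s : ℝ≥0} {f : (Fin n → ℂ) → ℂ}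
    {g : ι → (Fin n → ℂ) → ℂ} {c : ι → ℂ} (hc : Summable fun δ => ‖c δ‖)
    (hg : ∀ δ, MonoSeriesBound s 1 (g δ))
    (hf : ∀ w ∈ Metric.ball (0 : Fin n → ℂ) s, HasSum (fun δ => c δ * g δ w) (f w)) :
    ∃ b, HasMonoSeries s f b := by
  choose C hC hC1 using hg
  refine ⟨fun β => ∑' δ, c δ * C δ β, fun w hw => ?_⟩
  have hsum : Summable fun p : ι × (Fin n → ℕ) => c p.1 * C p.1 p.2 * mono p.2 w := by
    refine Summable.of_enorm (ne_top_of_le_ne_top (b := ∑' δ, ‖c δ‖ₑ) ?_ ?_)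
    · have := hc.tsum_ofReal_ne_top
      simpa [ofReal_norm] using this
    · rw [ENNReal.tsum_prod (f := fun δ β => ‖c δ * C δ β * mono β w‖ₑ)]
      refine ENNReal.tsum_le_tsum fun δ => ?_
      simp_rw [mul_assoc, enorm_mul]
      rw [ENNReal.tsum_mul_left]
      refine mul_le_of_le_one_right' (le_trans (ENNReal.tsum_le_tsum fun β => ?_) (hC1 δ))
      gcongr
      exact enorm_mono_le β (mem_ball_zero_iff.1 hw).le
  have h1 : HasSum (fun p : ι × (Fin n → ℕ) => c p.1 * C p.1 p.2 * mono p.2 w) (f w) := by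
    have h2 := hsum.hasSum.prod_fiberwise (g := fun δ => c δ * g δ w) fun δ => by
      simpa [mul_assoc] using (hC δ w hw).mul_left (c δ)
    rw [(hf w hw).unique h2]
    exact hsum.hasSum
  have h3 := (Equiv.prodComm _ _).hasSum_iff.2 h1
  refine h3.prod_fiberwise fun β => ?_
  have h4 : Summable fun δ => c δ * C δ β * mono β w := h3.summable.prod_factor β
  simpa [tsum_mul_right] using h4.hasSum

/-- A function with absolutely summable Taylor coefficients, composed with a linear map, is again
the sum of a monomial series near `0`. -/
theorem SwitchedKoopman.HasSummableTaylor.exists_hasMonoSeries_comp {f : (Fin n → ℂ) → ℂ}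
    (hf : HasSummableTaylor f) (P : Matrix (Fin n) (Fin n) ℂ) :
    ∃ s : ℝ, 0 < s ∧ ∃ b, HasMonoSeries s (fun w => f (P.mulVec w)) b := by
  obtain ⟨c, hc, hf⟩ := hf
  rw [polydisk_eq_ball one_pos] at hf
  obtain ⟨M, hM⟩ : ∃ M : ℝ≥0, M = 1 + ∑ l, ∑ k, ‖P l k‖₊ := ⟨_, rfl⟩
  have hM0 : 0 < M := by rw [hM]; positivity
  have hrow : ∀ l, ∑ k, ‖P l k‖₊ ≤ M := fun l => by
    rw [hM]
    exact (Finset.single_le_sum (f := fun l => ∑ k, ‖P l k‖₊) (fun _ _ => zero_le)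
      (Finset.mem_univ l)).trans le_add_self
  refine ⟨(M⁻¹ : ℝ≥0), by positivity, hasMonoSeries_of_hasSum hc
    (fun δ => monoSeriesBound_mono_comp P (fun l => ?_) δ) fun w hw => hf _ ?_⟩
  · have : (∑ k, ‖P l k‖₊) * M⁻¹ ≤ 1 := by
      rw [← div_eq_mul_inv]
      exact div_le_one_of_le₀ (hrow l) zero_le
    simp_rw [enorm_eq_nnnorm]
    exact_mod_cast this
  · rw [mem_ball_zero_iff, pi_norm_lt_iff one_pos]
    intro l
    rw [mem_ball_zero_iff] at hw
    calc ‖P.mulVec w l‖ ≤ (∑ k, ‖P l k‖) * ‖w‖ := by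
          rw [Matrix.mulVec, dotProduct, Finset.sum_mul]
          refine norm_sum_le_of_le _ fun k _ => ?_
          rw [norm_mul]
          gcongr
          exact norm_le_pi_norm w k
      _ ≤ M * ‖w‖ := by
          gcongr
          simpa using NNReal.coe_le_coe.2 (hrow l)
      _ < M * (M⁻¹ : ℝ≥0) := by gcongr
      _ = 1 := by
          rw [← NNReal.coe_mul, mul_inv_cancel₀ hM0.ne', NNReal.coe_one]

/-! ### Entries of the Koopman matrix. -/

/-- The entry `⟨L_G z^β, z^γ⟩` of the Koopman matrix in terms of the Taylor coefficients `b l` of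
the components of `G`. -/
noncomputable def koopmanCoeff (b : Fin n → (Fin n → ℕ) → ℂ) (β γ : Fin n → ℕ) : ℂ :=
  ∑ l, (β l : ℂ) * shiftCoeff (β - Pi.single l 1) (b l) γ

theorem hasMonoSeries_monoDeriv {s : ℝ} {G : (Fin n → ℂ) → Fin n → ℂ}
    {b : Fin n → (Fin n → ℕ) → ℂ} (h : ∀ l, HasMonoSeries s (fun w => G w l) (b l))
    (β : Fin n → ℕ) : HasMonoSeries s (fun w => monoDeriv β w (G w)) (koopmanCoeff b β) :=
  (HasMonoSeries.sum Finset.univ fun l _ =>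
    ((h l).mono_mul (β - Pi.single l 1)).const_mul (β l : ℂ)).congr fun w _ => by
      simp [monoDeriv_apply, mul_assoc]

theorem koopmanEntry_eq {s : ℝ} (hs : 0 < s) {G : (Fin n → ℂ) → Fin n → ℂ}
    {b : Fin n → (Fin n → ℕ) → ℂ} (h : ∀ l, HasMonoSeries s (fun w => G w l) (b l))
    (β γ : Fin n → ℕ) : koopmanEntry G β γ = koopmanCoeff b β γ := by
  refine HasMonoSeries.taylorCoeff_eq hs ?_ γ
  convert hasMonoSeries_monoDeriv h β using 2 with w
  rw [koopmanGenerator, (hasFDerivAt_mono β w).fderiv]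

theorem deg_eq_sub_single {β : Fin n → ℕ} {l : Fin n} (hl : β l ≠ 0) :
    deg β = deg (β - Pi.single l 1) + 1 := by
  conv_lhs => rw [← sub_single_add hl, deg_add, deg_single]

theorem deg_eq_zero {η : Fin n → ℕ} : deg η = 0 ↔ η = 0 := by
  simp [deg, funext_iff]

theorem deg_eq_one {η : Fin n → ℕ} : deg η = 1 ↔ ∃ r, η = Pi.single r 1 := by
  constructor
  · intro h
    obtain ⟨r, hr⟩ : ∃ r, η r ≠ 0 := by
      by_contra! hc
      have : deg η = 0 := by simp [deg, hc]
      omega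
    refine ⟨r, ?_⟩
    rw [deg_eq_sub_single hr] at h
    have h0 := deg_eq_zero.1 (show deg (η - Pi.single r 1) = 0 by omega)
    rw [← sub_single_add hr, h0, zero_add]
  · rintro ⟨r, rfl⟩
    exact deg_single r

theorem koopmanCoeff_zero_left (b : Fin n → (Fin n → ℕ) → ℂ) (γ : Fin n → ℕ) :
    koopmanCoeff b 0 γ = 0 := by
  simp [koopmanCoeff]

theorem koopmanCoeff_self (b : Fin n → (Fin n → ℕ) → ℂ) (β : Fin n → ℕ) :
    koopmanCoeff b β β = ∑ l, (β l : ℂ) * b l (Pi.single l 1) := by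
  refine Finset.sum_congr rfl fun l _ => ?_
  by_cases hl : β l = 0
  · simp [hl]
  · congr 1
    have h := shiftCoeff_add (β - Pi.single l 1) (b l) (Pi.single l 1)
    rwa [add_comm, sub_single_add hl] at h

theorem koopmanCoeff_single (b : Fin n → (Fin n → ℕ) → ℂ) (l : Fin n) (γ : Fin n → ℕ) :
    koopmanCoeff b (Pi.single l 1) γ = b l γ := by
  rw [koopmanCoeff, Finset.sum_eq_single l]
  · simp [shiftCoeff]
  · intro j _ hj
    simp [hj]
  · simp

/-- The terms of order at least two of a family of power series. -/
def highOrder (b : Fin n → (Fin n → ℕ) → ℂ) (l : Fin n) (η : Fin n → ℕ) : ℂ :=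
  if deg η ≤ 1 then 0 else b l η

/-- A term of order `|η|` in `b l` sends `z^β` to degree `|β| - 1 + |η|`, so the terms of order at
least two produce exactly the entries that raise the degree. -/
theorem koopmanCoeff_highOrder (b : Fin n → (Fin n → ℕ) → ℂ) (β γ : Fin n → ℕ) :
    koopmanCoeff (highOrder b) β γ = if deg β < deg γ then koopmanCoeff b β γ else 0 := by
  have h : ∀ l, (β l : ℂ) * shiftCoeff (β - Pi.single l 1) (highOrder b l) γ =
      if deg β < deg γ then (β l : ℂ) * shiftCoeff (β - Pi.single l 1) (b l) γ else 0 := by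
    intro l
    by_cases hl : β l = 0
    · simp [hl]
    by_cases hle : β - Pi.single l 1 ≤ γ
    · obtain ⟨η, rfl⟩ : ∃ η, γ = η + (β - Pi.single l 1) := ⟨_, (tsub_add_cancel_of_le hle).symm⟩
      rw [shiftCoeff_add, shiftCoeff_add, deg_add, deg_eq_sub_single hl, highOrder]
      by_cases h1 : deg η ≤ 1
      · rw [if_pos h1, if_neg (by omega), mul_zero]
      · rw [if_neg h1, if_pos (by omega)]
    · simp [shiftCoeff, hle]
  rw [koopmanCoeff, Finset.sum_congr rfl fun l _ => h l]
  split_ifs <;> simp [koopmanCoeff]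

/-- Each term replaces a factor `z_l` by a monomial of positive degree, since `b l` has no constant
term. Columns of the Koopman matrix are therefore finitely supported. -/
theorem deg_le_of_koopmanCoeff_ne_zero {b : Fin n → (Fin n → ℕ) → ℂ} (hb : ∀ l, b l 0 = 0)
    {β γ : Fin n → ℕ} (h : koopmanCoeff b β γ ≠ 0) : deg β ≤ deg γ := by
  obtain ⟨l, -, hl⟩ := Finset.exists_ne_zero_of_sum_ne_zero h
  have h1 : β l ≠ 0 := fun h => hl (by simp [h])
  have h2 : β - Pi.single l 1 ≤ γ := by
    by_contra hc
    exact hl (by simp [shiftCoeff, hc])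
  obtain ⟨η, rfl⟩ : ∃ η, γ = η + (β - Pi.single l 1) := ⟨_, (tsub_add_cancel_of_le h2).symm⟩
  have h3 : deg η ≠ 0 := fun h0 => hl (by
    rw [shiftCoeff_add, deg_eq_zero.1 h0, hb, mul_zero])
  rw [deg_add, deg_eq_sub_single h1]
  omega

theorem finite_deg_le (d : ℕ) : {β : Fin n → ℕ | deg β ≤ d}.Finite :=
  (Set.finite_Iic (fun _ => d : Fin n → ℕ)).subset fun β hβ l =>
    (Finset.single_le_sum (f := β) (fun _ _ => zero_le) (Finset.mem_univ l)).trans hβ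

theorem tsum_enorm_koopmanCoeff_row_le (b : Fin n → (Fin n → ℕ) → ℂ) (β : Fin n → ℕ) :
    ∑' γ, ‖koopmanCoeff b β γ‖ₑ ≤ ∑ l, (β l : ℝ≥0∞) * ∑' η, ‖b l η‖ₑ := by
  calc ∑' γ, ‖koopmanCoeff b β γ‖ₑ
      ≤ ∑' γ, ∑ l, (β l : ℝ≥0∞) * ‖shiftCoeff (β - Pi.single l 1) (b l) γ‖ₑ := by
        refine ENNReal.tsum_le_tsum fun γ => (enorm_sum_le _ _).trans (le_of_eq ?_)
        refine Finset.sum_congr rfl fun l _ => ?_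
        rw [enorm_mul]
        congr 1
        simp [enorm_eq_nnnorm]
    _ = ∑ l, (β l : ℝ≥0∞) * ∑' η, ‖b l η‖ₑ := by
        rw [Summable.tsum_finsetSum fun _ _ => ENNReal.summable]
        refine Finset.sum_congr rfl fun l _ => ?_
        rw [ENNReal.tsum_mul_left]
        congr 1
        simpa using tsum_enorm_shiftCoeff_mul (β - Pi.single l 1) (b l) fun _ => 1

theorem tsum_enorm_koopmanCoeff_col_ne_top {b : Fin n → (Fin n → ℕ) → ℂ}
    (hb : ∀ l, b l 0 = 0) (γ : Fin n → ℕ) : ∑' β, ‖koopmanCoeff b β γ‖ₑ ≠ ⊤ := by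
  rw [tsum_eq_sum (s := (finite_deg_le (n := n) (deg γ)).toFinset)]
  · exact ENNReal.sum_ne_top.2 fun _ _ => enorm_ne_top
  · intro β hβ
    by_contra hc
    exact hβ (by simpa using deg_le_of_koopmanCoeff_ne_zero hb (enorm_ne_zero.1 hc))

/-- The linear part of a vector field vanishing at `0`, split off its power series. -/
theorem HasMonoSeries.sub_linear {s : ℝ} {G : (Fin n → ℂ) → Fin n → ℂ}
    {b : Fin n → (Fin n → ℕ) → ℂ} (hb : ∀ l, b l 0 = 0)
    (h : ∀ l, HasMonoSeries s (fun w => G w l) (b l)) (l : Fin n) :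
    HasMonoSeries s (fun w => G w l - ∑ r, b l (Pi.single r 1) * w r) (highOrder b l) := by
  intro w hw
  have hinj : Function.Injective fun r : Fin n => (Pi.single r 1 : Fin n → ℕ) := by
    intro r r' hrr
    by_contra hne
    have := congrFun hrr r
    simp [hne] at this
  have h1 : HasSum (fun η => (b l η - highOrder b l η) * mono η w)
      (∑ r, b l (Pi.single r 1) * w r) := by
    rw [← hinj.hasSum_iff]
    · convert hasSum_fintype fun r => b l (Pi.single r 1) * w r using 2 with r
      simp [highOrder]
    · intro η hη
      rcases lt_or_ge 1 (deg η) with h1 | h1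
      · simp [highOrder, not_le.2 h1]
      · have h0 : η = 0 := by
          rw [← deg_eq_zero]
          by_contra hne
          obtain ⟨r, rfl⟩ := deg_eq_one.1 (show deg η = 1 by omega)
          exact hη ⟨r, rfl⟩
        simp [h0, hb, highOrder]
  refine ((h l w hw).sub h1).congr_fun fun η => ?_
  ring

/-! ### Bounds for the off-diagonal part: Schur test and triangular entries. -/

theorem le_half_mul_add_of_sq_le {u κ p q : ℝ≥0} (h : u ^ 2 ≤ κ ^ 2 * (p * q)) :
    u ≤ κ / 2 * (p + q) := by
  rw [← pow_le_pow_iff_left₀ zero_le zero_le two_ne_zero]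
  refine h.trans ?_
  rw [← NNReal.coe_le_coe]
  push_cast
  nlinarith [sq_nonneg ((κ : ℝ) * (p - q))]

/-- A weighted Schur test for a nonnegative kernel. -/
theorem schur_test {ι : Type*} {k u : ι → ι → ℝ≥0} {R C y : ι → ℝ≥0} {κ : ℝ≥0}
    (hR : ∀ β, ∑' γ, (k β γ : ℝ≥0∞) ≤ R β) (hC : ∀ γ, ∑' β, (k β γ : ℝ≥0∞) ≤ C γ)
    (hu : ∀ β γ, k β γ ≠ 0 → u β γ ^ 2 * (R β * C γ) ≤ κ ^ 2 * (y β * y γ)) :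
    ∑' β, ∑' γ, ((k β γ * u β γ : ℝ≥0) : ℝ≥0∞) ≤ κ * ∑' β, (y β : ℝ≥0∞) := by
  -- The two weights in the arithmetic-geometric mean inequality are chosen so that summing over `γ`
  -- cancels `R β` and summing over `β` cancels `C γ`.
  have key : ∀ β γ, k β γ * u β γ ≤ κ / 2 * (y β / R β * k β γ) + κ / 2 * (y γ / C γ * k β γ) := by
    intro β γ
    by_cases hk : k β γ = 0
    · simp [hk]
    have hR0 : 0 < R β := by
      have := (ENNReal.le_tsum γ).trans (hR β)
      exact (pos_iff_ne_zero.2 hk).trans_le (by exact_mod_cast this)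
    have hC0 : 0 < C γ := by
      have := (ENNReal.le_tsum β).trans (hC γ)
      exact (pos_iff_ne_zero.2 hk).trans_le (by exact_mod_cast this)
    suffices h : u β γ ≤ κ / 2 * (y β / R β + y γ / C γ) by
      calc k β γ * u β γ ≤ k β γ * (κ / 2 * (y β / R β + y γ / C γ)) := by gcongr
        _ = _ := by ring
    have h1 : u β γ ^ 2 ≤ κ ^ 2 * (y β / R β * (y γ / C γ)) := by
      calc u β γ ^ 2 = u β γ ^ 2 * (R β * C γ) / (R β * C γ) := by field_simp
        _ ≤ κ ^ 2 * (y β * y γ) / (R β * C γ) := div_le_div_of_nonneg_right (hu β γ hk) zero_le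
        _ = _ := by field_simp
    exact le_half_mul_add_of_sq_le h1
  have hy : ∀ (a : ℝ≥0) (S : ℝ≥0) (t : ℝ≥0∞), t ≤ S → ((a / S : ℝ≥0) : ℝ≥0∞) * t ≤ a := by
    intro a S t ht
    calc ((a / S : ℝ≥0) : ℝ≥0∞) * t ≤ ((a / S : ℝ≥0) : ℝ≥0∞) * S := by gcongr
      _ ≤ a := by
        rw [← ENNReal.coe_mul, ENNReal.coe_le_coe]
        rcases eq_or_ne S 0 with rfl | hS
        · simp
        · exact (div_mul_cancel₀ a hS).le
  calc ∑' β, ∑' γ, ((k β γ * u β γ : ℝ≥0) : ℝ≥0∞)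
      ≤ ∑' β, ∑' γ, ((κ / 2 : ℝ≥0) * ((y β / R β : ℝ≥0) * (k β γ : ℝ≥0∞)) +
          (κ / 2 : ℝ≥0) * ((y γ / C γ : ℝ≥0) * (k β γ : ℝ≥0∞))) := by
        refine ENNReal.tsum_le_tsum fun β => ENNReal.tsum_le_tsum fun γ => ?_
        exact_mod_cast key β γ
    _ = (κ / 2 : ℝ≥0) * ∑' β, (y β / R β : ℝ≥0) * ∑' γ, (k β γ : ℝ≥0∞) +
          (κ / 2 : ℝ≥0) * ∑' γ, (y γ / C γ : ℝ≥0) * ∑' β, (k β γ : ℝ≥0∞) := by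
        simp_rw [ENNReal.tsum_add, ENNReal.tsum_mul_left]
        congr 2
        rw [ENNReal.tsum_comm]
        simp_rw [ENNReal.tsum_mul_left]
    _ ≤ (κ / 2 : ℝ≥0) * ∑' β, (y β : ℝ≥0∞) + (κ / 2 : ℝ≥0) * ∑' β, (y β : ℝ≥0∞) := by
        gcongr with β γ
        · exact hy _ _ _ (hR β)
        · exact hy _ _ _ (hC γ)
    _ = κ * ∑' β, (y β : ℝ≥0∞) := by
        rw [← add_mul, ← ENNReal.coe_add, add_halves]

/-- The diagonal entry of the Koopman matrix at `z^β`, for a linear part with diagonal `d`. -/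
def diagWeight (d : Fin n → ℝ≥0) (β : Fin n → ℕ) : ℝ≥0 := ∑ l, (β l : ℝ≥0) * d l

theorem diagWeight_add_single (d : Fin n → ℝ≥0) (η : Fin n → ℕ) (q : Fin n) :
    diagWeight d (η + Pi.single q 1) = diagWeight d η + d q := by
  simp only [diagWeight, Pi.add_apply, Nat.cast_add, add_mul, Finset.sum_add_distrib]
  congr 1
  rw [Finset.sum_eq_single q] <;> simp +contextual

theorem mul_le_diagWeight (d : Fin n → ℝ≥0) (β : Fin n → ℕ) (q : Fin n) :
    (β q : ℝ≥0) * d q ≤ diagWeight d β :=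
  Finset.single_le_sum (f := fun l => (β l : ℝ≥0) * d l) (fun _ _ => zero_le) (Finset.mem_univ q)

/-- The contribution of one off-diagonal entry of the linear part to the derivative of a weighted
sum of squares of monomials. -/
theorem tsum_linear_entry_le {d : Fin n → ℝ≥0} {x : (Fin n → ℕ) → ℝ≥0} {ε : ℕ → ℝ≥0}
    {q r : Fin n} {t c : ℝ≥0} (h1 : t ^ 2 ≤ c ^ 2 * (d q * d r)) (h2 : t ≤ c * d q) :
    ∑' β, ((ε (deg β) * (β q * t * (x β * x (β - Pi.single q 1 + Pi.single r 1 : Fin n → ℕ))) :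
      ℝ≥0) : ℝ≥0∞) ≤
      c * ∑' β, ((ε (deg β) * (diagWeight d β * x β ^ 2) : ℝ≥0) : ℝ≥0∞) := by
  have hsupp : Function.support (fun β : Fin n → ℕ => ((ε (deg β) *
      (β q * t * (x β * x (β - Pi.single q 1 + Pi.single r 1 : Fin n → ℕ))) : ℝ≥0) : ℝ≥0∞)) ⊆
      Set.range fun η : Fin n → ℕ => η + Pi.single q 1 := by
    intro β hβ
    refine ⟨β - Pi.single q 1, sub_single_add fun h => hβ ?_⟩
    simp [h]
  -- Only `β = η + e_q` contributes. The entry then couples `η + e_q` with `η + e_r`, which have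
  -- equal degree and hence the same weight `ε`.
  rw [← (add_left_injective (Pi.single q 1 : Fin n → ℕ)).tsum_eq hsupp]
  set y : (Fin n → ℕ) → ℝ≥0 := fun β => ε (deg β) * (diagWeight d β * x β ^ 2) with hy
  have key : ∀ η : Fin n → ℕ, ε (deg (η + Pi.single q 1)) * ((η + Pi.single q 1 : Fin n → ℕ) q * t *
      (x (η + Pi.single q 1) * x (η + Pi.single q 1 - Pi.single q 1 + Pi.single r 1 : Fin n → ℕ))) ≤
      c / 2 * y (η + Pi.single q 1) + c / 2 * y (η + Pi.single r 1) := by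
    intro η
    rw [add_tsub_cancel_right]
    simp only [hy, deg_add, deg_single, diagWeight_add_single]
    have hD := mul_le_diagWeight d η q
    -- Both hypotheses enter here: in `(η_q + 1)² t² = (η_q + 1)(η_q t² + t²)` the first `t²` is
    -- bounded by `(c d_q)²` and the second by `c² d_q d_r`, so that the product of the two diagonal
    -- weights appears.
    have ha : (((η q + 1 : ℕ) : ℝ≥0) * t) ^ 2 ≤
        c ^ 2 * ((diagWeight d η + d q) * (diagWeight d η + d r)) := by
      calc (((η q + 1 : ℕ) : ℝ≥0) * t) ^ 2 = (η q + 1) * (η q * t ^ 2 + t ^ 2) := by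
            push_cast; ring
        _ ≤ (η q + 1) * (η q * (c * d q) ^ 2 + c ^ 2 * (d q * d r)) := by gcongr
        _ = c ^ 2 * ((η q * d q + d q) * (η q * d q + d r)) := by ring
        _ ≤ _ := by gcongr
    have := le_half_mul_add_of_sq_le (u := ((η q + 1 : ℕ) : ℝ≥0) * t *
      (x (η + Pi.single q 1) * x (η + Pi.single r 1))) (κ := c)
      (p := (diagWeight d η + d q) * x (η + Pi.single q 1) ^ 2)
      (q := (diagWeight d η + d r) * x (η + Pi.single r 1) ^ 2) (by
        calc _ = (((η q + 1 : ℕ) : ℝ≥0) * t) ^ 2 *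
              (x (η + Pi.single q 1) * x (η + Pi.single r 1)) ^ 2 := by ring
          _ ≤ c ^ 2 * ((diagWeight d η + d q) * (diagWeight d η + d r)) *
              (x (η + Pi.single q 1) * x (η + Pi.single r 1)) ^ 2 := by gcongr
          _ = _ := by ring)
    calc _ ≤ ε (deg η + 1) * (c / 2 * ((diagWeight d η + d q) * x (η + Pi.single q 1) ^ 2 +
          (diagWeight d η + d r) * x (η + Pi.single r 1) ^ 2)) := by
            refine mul_le_mul_of_nonneg_left ?_ zero_le
            simpa using this
      _ = _ := by ring
  calc _ ≤ ∑' η, ((c / 2 : ℝ≥0) * (y (η + Pi.single q 1) : ℝ≥0∞) +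
        (c / 2 : ℝ≥0) * (y (η + Pi.single r 1) : ℝ≥0∞)) :=
        ENNReal.tsum_le_tsum fun η => by exact_mod_cast key η
    _ = (c / 2 : ℝ≥0) * ∑' η, (y (η + Pi.single q 1) : ℝ≥0∞) +
        (c / 2 : ℝ≥0) * ∑' η, (y (η + Pi.single r 1) : ℝ≥0∞) := by
        rw [ENNReal.tsum_add, ENNReal.tsum_mul_left, ENNReal.tsum_mul_left]
    _ ≤ (c / 2 : ℝ≥0) * ∑' β, (y β : ℝ≥0∞) + (c / 2 : ℝ≥0) * ∑' β, (y β : ℝ≥0∞) := by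
        refine add_le_add (mul_le_mul_of_nonneg_left ?_ zero_le)
          (mul_le_mul_of_nonneg_left ?_ zero_le)
        · exact ENNReal.tsum_comp_le_tsum_of_injective
            (add_left_injective (Pi.single q 1 : Fin n → ℕ)) fun β => (y β : ℝ≥0∞)
        · exact ENNReal.tsum_comp_le_tsum_of_injective
            (add_left_injective (Pi.single r 1 : Fin n → ℕ)) fun β => (y β : ℝ≥0∞)
    _ = c * ∑' β, (y β : ℝ≥0∞) := by
        rw [← add_mul, ← ENNReal.coe_add, add_halves]

/-- The pairs of indices above the diagonal. -/
def upperPairs (n : ℕ) : Finset (Fin n × Fin n) := Finset.univ.filter fun p => p.1 < p.2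

theorem two_mul_card_upperPairs (n : ℕ) : 2 * (upperPairs n).card + n = n ^ 2 := by
  have h1 : (upperPairs n).card =
      (Finset.univ.filter fun p : Fin n × Fin n => p.2 < p.1).card := by
    refine Finset.card_bij (fun p _ => p.swap) ?_ ?_ ?_
    · simp [upperPairs]
    · intro p _ q _ h
      exact Prod.swap_injective h
    · intro p hp
      exact ⟨p.swap, by simpa [upperPairs] using hp, by simp⟩
  have h2 : (Finset.univ.filter fun p : Fin n × Fin n => p.1 = p.2).card = n := by
    rw [show (Finset.univ.filter fun p : Fin n × Fin n => p.1 = p.2) = Finset.univ.diag by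
      ext; simp, Finset.diag_card, Finset.card_fin]
  have h3 := Finset.card_filter_add_card_filter_not (s := (Finset.univ : Finset (Fin n × Fin n)))
    (fun p => p.1 < p.2)
  have h4 := Finset.card_filter_add_card_filter_not
    (s := Finset.univ.filter fun p : Fin n × Fin n => ¬ p.1 < p.2) (fun p => p.2 < p.1)
  have h5 : ((Finset.univ.filter fun p : Fin n × Fin n => ¬ p.1 < p.2).filter
      fun p => p.2 < p.1) = Finset.univ.filter fun p : Fin n × Fin n => p.2 < p.1 := by
    ext p; simp; intro h; exact h.le
  have h6 : ((Finset.univ.filter fun p : Fin n × Fin n => ¬ p.1 < p.2).filter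
      fun p => ¬ p.2 < p.1) = Finset.univ.filter fun p : Fin n × Fin n => p.1 = p.2 := by
    ext p; simp; exact ⟨fun h => le_antisymm h.2 h.1, fun h => ⟨h.ge, h.le⟩⟩
  rw [h5, h6] at h4
  simp only [Finset.card_univ, Fintype.card_prod, Fintype.card_fin] at h3
  rw [upperPairs] at *
  nlinarith

/-! ### The derivative of the Lyapunov function. -/

/-- The vector of squared moduli of the coordinates. -/
noncomputable def sqModulus (w : Fin n → ℂ) (l : Fin n) : ℂ := ((‖w l‖ ^ 2 : ℝ) : ℂ)

theorem mono_sqModulus (β : Fin n → ℕ) (w : Fin n → ℂ) :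
    mono β (sqModulus w) = ((‖mono β w‖ ^ 2 : ℝ) : ℂ) := by
  rw [norm_mono, ← Finset.prod_pow, mono, Complex.ofReal_prod]
  refine Finset.prod_congr rfl fun l _ => ?_
  rw [sqModulus, ← Complex.ofReal_pow]
  congr 1
  ring

theorem mono_sub_single_mul {β : Fin n → ℕ} {l : Fin n} (hl : β l ≠ 0) (w : Fin n → ℂ) :
    mono (β - Pi.single l 1) w * w l = mono β w := by
  conv_rhs => rw [← sub_single_add hl, mono_add, mono_single]

/-- Along a solution of `ẇ = g`, the derivative of `|w^β|²`, computed through the squared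
moduli. -/
theorem monoDeriv_sqModulus (β : Fin n → ℕ) (w g : Fin n → ℂ) :
    monoDeriv β (sqModulus w) (fun l => ((2 * (conj (w l) * g l).re : ℝ) : ℂ)) =
      ((2 * (conj (mono β w) * monoDeriv β w g).re : ℝ) : ℂ) := by
  rw [monoDeriv_apply, monoDeriv_apply, Finset.mul_sum, Complex.re_sum, Finset.mul_sum,
    Complex.ofReal_sum]
  refine Finset.sum_congr rfl fun l _ => ?_
  by_cases hl : β l = 0
  · simp [hl]
  rw [mono_sqModulus, ← Complex.ofReal_natCast, ← Complex.ofReal_mul, ← Complex.ofReal_mul]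
  congr 1
  have h : conj (mono β w) * (((β l : ℝ) : ℂ) * mono (β - Pi.single l 1) w * g l) =
      (((β l : ℝ) * ‖mono (β - Pi.single l 1) w‖ ^ 2 : ℝ) : ℂ) * (conj (w l) * g l) := by
    rw [← mono_sub_single_mul hl, map_mul, Complex.ofReal_mul, Complex.ofReal_pow,
      ← Complex.conj_mul']
    ring
  rw [h, Complex.re_ofReal_mul]
  ring

/-- The diagonal of `T` gives the decay, the entries below it vanish, and an entry `T q r` above it
replaces one factor `w_q` of `w^β` by `w_r`; that term is bounded by its modulus. -/
theorem re_linear_part_le {T : Matrix (Fin n) (Fin n) ℂ} (hT : T.BlockTriangular id)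
    {d : Fin n → ℝ≥0} (hd : ∀ l, (T l l).re = -(d l : ℝ)) (β : Fin n → ℕ) (w : Fin n → ℂ) :
    (conj (mono β w) * monoDeriv β w fun l => ∑ r, T l r * w r).re ≤
      -((diagWeight d β * ‖mono β w‖₊ ^ 2 : ℝ≥0) : ℝ) +
      ((∑ p ∈ upperPairs n, β p.1 * ‖T p.1 p.2‖₊ *
        (‖mono β w‖₊ * ‖mono (β - Pi.single p.1 1 + Pi.single p.2 1) w‖₊) : ℝ≥0) : ℝ) := by
  have hterm : ∀ l r, (conj (mono β w) *
      ((β l : ℂ) * mono (β - Pi.single l 1) w * (T l r * w r))).re ≤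
      (if l = r then -((β l : ℝ) * d l * ‖mono β w‖ ^ 2) else 0) +
      (if l < r then (β l : ℝ) * ‖T l r‖ *
        (‖mono β w‖ * ‖mono (β - Pi.single l 1 + Pi.single r 1) w‖) else 0) := by
    intro l r
    rcases lt_trichotomy l r with h | rfl | h
    · rw [if_neg h.ne, if_pos h, zero_add]
      refine (Complex.re_le_norm _).trans (le_of_eq ?_)
      simp only [norm_mul, Complex.norm_natCast, mono_add, mono_single, Complex.norm_conj]
      ring
    · rw [if_pos rfl, if_neg (lt_irrefl _), add_zero]
      by_cases hl : β l = 0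
      · simp [hl]
      have : conj (mono β w) * ((β l : ℂ) * mono (β - Pi.single l 1) w * (T l l * w l)) =
          ((β l * ‖mono β w‖ ^ 2 : ℝ) : ℂ) * T l l := by
        push_cast
        rw [← Complex.conj_mul', ← mono_sub_single_mul hl]
        ring
      rw [this, Complex.re_ofReal_mul, hd]
      apply le_of_eq
      ring
    · rw [hT h]
      simp [h.ne', h.not_gt]
  rw [monoDeriv_apply, Finset.mul_sum, Complex.re_sum]
  calc _ = ∑ l, ∑ r, (conj (mono β w) *
        ((β l : ℂ) * mono (β - Pi.single l 1) w * (T l r * w r))).re := by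
        refine Finset.sum_congr rfl fun l _ => ?_
        rw [Finset.mul_sum, Finset.mul_sum, Complex.re_sum]
    _ ≤ ∑ l, ∑ r, _ := Finset.sum_le_sum fun l _ => Finset.sum_le_sum fun r _ => hterm l r
    _ = _ := by
        simp_rw [Finset.sum_add_distrib]
        congr 1
        · simp [diagWeight, Finset.sum_mul]
        · rw [upperPairs, Finset.sum_filter, ← Finset.univ_product_univ, Finset.sum_product]
          push_cast
          refine Finset.sum_congr rfl fun l _ => Finset.sum_congr rfl fun r _ => ?_
          split_ifs <;> simp

/-- The derivative of the Lyapunov function `∑ ε_{|β|} |w^β|²` along `ẇ = G(w)`. -/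
theorem lyapunov_deriv_le {G : (Fin n → ℂ) → Fin n → ℂ} {b : Fin n → (Fin n → ℕ) → ℂ}
    (hb : ∀ l, b l 0 = 0) (hG : ∀ l, HasMonoSeries 1 (fun w => G w l) (b l))
    {T : Matrix (Fin n) (Fin n) ℂ} (hbT : ∀ l r, b l (Pi.single r 1) = T l r)
    (hT : T.BlockTriangular id) {d : Fin n → ℝ≥0} (hd : ∀ l, (T l l).re = -(d l : ℝ))
    {c ξ κ : ℝ≥0} (hcξ : (upperPairs n).card * c ≤ ξ)
    (hT1 : ∀ q r, q < r → ‖T q r‖₊ ^ 2 ≤ c ^ 2 * (d q * d r))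
    (hT2 : ∀ q r, q < r → ‖T q r‖₊ ≤ c * d q) {ε : ℕ → ℝ≥0} {R C : (Fin n → ℕ) → ℝ≥0}
    (hR : ∀ β, ∑' γ, ‖koopmanCoeff b β γ‖ₑ ≤ R β) (hC : ∀ γ, ∑' β, ‖koopmanCoeff b β γ‖ₑ ≤ C γ)
    (hε : ∀ β γ, deg β < deg γ → koopmanCoeff b β γ ≠ 0 →
      ε (deg β) * (R β * C γ) ≤ κ ^ 2 * (diagWeight d β * diagWeight d γ) * ε (deg γ))
    {w : Fin n → ℂ} (hw : w ∈ Metric.ball (0 : Fin n → ℂ) 1)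
    {f' : (Fin n → ℂ) →L[ℂ] ℂ}
    (hf' : ∀ v, HasSum (fun β => (ε (deg β) : ℂ) * monoDeriv β (sqModulus w) v) (f' v)) :
    ∃ Y : ℝ≥0, HasSum (fun β => ε (deg β) * (diagWeight d β * ‖mono β w‖₊ ^ 2)) Y ∧
      (f' fun l => ((2 * (conj (w l) * G w l).re : ℝ) : ℂ)).re ≤ 2 * (-1 + (ξ + κ)) * Y := by
  set x : (Fin n → ℕ) → ℝ≥0 := fun β => ‖mono β w‖₊ with hx
  set y : (Fin n → ℕ) → ℝ≥0 := fun β => ε (deg β) * (diagWeight d β * x β ^ 2) with hy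
  have hysum : Summable y := by
    -- In the direction `d l * p l` the derivative of `p^β` is `diagWeight d β * p^β`, so
    -- convergence of the series for `Y` is contained in that of the differentiated series.
    have h := Complex.hasSum_re (hf' fun l => d l * sqModulus w l)
    rw [← NNReal.summable_coe]
    refine h.summable.congr fun β => ?_
    have h1 : ∀ l, (β l : ℂ) * mono (β - Pi.single l 1) (sqModulus w) * (d l * sqModulus w l) =
        ((β l * d l * x β ^ 2 : ℝ≥0) : ℂ) := by
      intro l
      by_cases hl : β l = 0
      · simp [hl]
      have h2 := mono_sub_single_mul hl (sqModulus w)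
      rw [mono_sqModulus β] at h2
      calc _ = (β l : ℂ) * d l * (mono (β - Pi.single l 1) (sqModulus w) * sqModulus w l) := by ring
        _ = _ := by rw [h2]; simp [hx]
    rw [Complex.re_ofReal_mul, monoDeriv_apply, Finset.sum_congr rfl fun l _ => h1 l,
      ← Complex.ofReal_sum, Complex.ofReal_re, ← NNReal.coe_sum, ← NNReal.coe_mul]
    simp only [hy, diagWeight, Finset.sum_mul]
  obtain ⟨Y, hY⟩ := hysum
  have hYe : ∑' β, (y β : ℝ≥0∞) = Y := by
    rw [← ENNReal.coe_tsum hY.summable, hY.tsum_eq]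
  refine ⟨Y, hY, ?_⟩
  -- the linear off-diagonal part
  set B : (Fin n → ℕ) → ℝ≥0 := fun β => ε (deg β) * ∑ p ∈ upperPairs n, β p.1 * ‖T p.1 p.2‖₊ *
    (x β * x (β - Pi.single p.1 1 + Pi.single p.2 1)) with hB
  have hBsum : ∑' β, (B β : ℝ≥0∞) ≤ (ξ * Y : ℝ≥0) := by
    calc ∑' β, (B β : ℝ≥0∞) = ∑ p ∈ upperPairs n, ∑' β, ((ε (deg β) * (β p.1 * ‖T p.1 p.2‖₊ *
          (x β * x (β - Pi.single p.1 1 + Pi.single p.2 1 : Fin n → ℕ))) : ℝ≥0) : ℝ≥0∞) := by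
          rw [← Summable.tsum_finsetSum fun _ _ => ENNReal.summable]
          simp only [hB, Finset.mul_sum, ENNReal.ofNNReal_finsetSum]
      _ ≤ ∑ p ∈ upperPairs n, (c : ℝ≥0∞) * Y := by
          refine Finset.sum_le_sum fun p hp => ?_
          have hlt : p.1 < p.2 := (Finset.mem_filter.1 hp).2
          rw [← hYe]
          exact tsum_linear_entry_le (hT1 _ _ hlt) (hT2 _ _ hlt)
      _ ≤ (ξ * Y : ℝ≥0) := by
          rw [Finset.sum_const, nsmul_eq_mul, ← mul_assoc, ENNReal.coe_mul]
          gcongr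
          exact_mod_cast hcξ
  -- the part of higher order
  set H : (Fin n → ℂ) → Fin n → ℂ := fun w l => G w l - ∑ r, b l (Pi.single r 1) * w r with hH
  have hHs : ∀ l, HasMonoSeries 1 (fun w => H w l) (highOrder b l) := fun l =>
    HasMonoSeries.sub_linear hb hG l
  set E : (Fin n → ℕ) → ℝ≥0 := fun β => ε (deg β) * (x β * ‖monoDeriv β w (H w)‖₊) with hE
  have hkle : ∀ β γ, ‖koopmanCoeff (highOrder b) β γ‖ₑ ≤ ‖koopmanCoeff b β γ‖ₑ := by
    intro β γ
    rw [koopmanCoeff_highOrder]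
    split_ifs <;> simp
  have hEsum : ∑' β, (E β : ℝ≥0∞) ≤ (κ * Y : ℝ≥0) := by
    rw [ENNReal.coe_mul, ← hYe]
    -- The kernel carries only the weight of the row index `β`. Squared, it contains `ε (deg β)`
    -- twice, and `hε` exchanges one of the two for `ε (deg γ)`.
    refine le_trans (ENNReal.tsum_le_tsum fun β => ?_) (schur_test (R := R) (C := C) (κ := κ)
      (y := y) (k := fun β γ => ‖koopmanCoeff (highOrder b) β γ‖₊)
      (u := fun β γ => ε (deg β) * (x β * x γ))
      (fun β => le_trans (ENNReal.tsum_le_tsum fun γ => hkle β γ) (hR β))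
      (fun γ => le_trans (ENNReal.tsum_le_tsum fun β => hkle β γ) (hC γ)) ?_)
    · have h1 := hasMonoSeries_monoDeriv hHs β w hw
      have h2 : ‖monoDeriv β w (H w)‖ₑ ≤
          ∑' γ, ‖koopmanCoeff (highOrder b) β γ‖ₑ * ‖mono γ w‖ₑ := by
        refine (congrArg _ h1.tsum_eq.symm).trans_le ?_
        refine (enorm_tsum_le_tsum_enorm).trans (le_of_eq ?_)
        simp_rw [enorm_mul]
      calc (E β : ℝ≥0∞) = ε (deg β) * (x β * ‖monoDeriv β w (H w)‖ₑ) := by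
            simp [hE, enorm_eq_nnnorm]
        _ ≤ ε (deg β) * (x β * ∑' γ, ‖koopmanCoeff (highOrder b) β γ‖ₑ * ‖mono γ w‖ₑ) := by gcongr
        _ = _ := by
            rw [← ENNReal.tsum_mul_left, ← ENNReal.tsum_mul_left]
            refine tsum_congr fun γ => ?_
            simp only [enorm_eq_nnnorm, hx, ← ENNReal.coe_mul]
            congr 1
            ring
    · intro β γ hk
      rw [nnnorm_ne_zero_iff, koopmanCoeff_highOrder] at hk
      have hdeg : deg β < deg γ := by
        by_contra hc
        exact hk (if_neg hc)
      rw [if_pos hdeg] at hk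
      calc (ε (deg β) * (x β * x γ)) ^ 2 * (R β * C γ)
          = ε (deg β) * (x β * x γ) ^ 2 * (ε (deg β) * (R β * C γ)) := by ring
        _ ≤ ε (deg β) * (x β * x γ) ^ 2 *
            (κ ^ 2 * (diagWeight d β * diagWeight d γ) * ε (deg γ)) := by
            exact mul_le_mul_of_nonneg_left (hε β γ hdeg hk) zero_le
        _ = κ ^ 2 * (y β * y γ) := by simp only [hy]; ring
  have toReal : ∀ {g : (Fin n → ℕ) → ℝ≥0} {a : ℝ≥0}, ∑' β, (g β : ℝ≥0∞) ≤ a →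
      Summable (fun β => (g β : ℝ)) ∧ ∑' β, (g β : ℝ) ≤ a := by
    intro g a h
    have hs : Summable g :=
      ENNReal.tsum_coe_ne_top_iff_summable.1 (ne_top_of_le_ne_top ENNReal.coe_ne_top h)
    refine ⟨NNReal.summable_coe.2 hs, ?_⟩
    rw [← ENNReal.coe_tsum hs, ENNReal.coe_le_coe] at h
    exact_mod_cast h
  obtain ⟨hB1, hB2⟩ := toReal hBsum
  obtain ⟨hE1, hE2⟩ := toReal hEsum
  have hsum := Complex.hasSum_re (hf' fun l => ((2 * (conj (w l) * G w l).re : ℝ) : ℂ))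
  have hYr : HasSum (fun β => (y β : ℝ)) Y := NNReal.hasSum_coe.2 hY
  have hle := hasSum_le (fun β => ?_) hsum
    (((hYr.neg.add hB1.hasSum).add hE1.hasSum).mul_left (2 : ℝ))
  · push_cast at hB2 hE2
    refine hle.trans ?_
    linarith
  · rw [monoDeriv_sqModulus]
    have hGw : G w = (fun l => ∑ r, T l r * w r) + H w := by
      funext l
      simp [hH, hbT]
    have h1 := re_linear_part_le hT hd β w
    have h2 : (conj (mono β w) * monoDeriv β w (H w)).re ≤ x β * ‖monoDeriv β w (H w)‖₊ := by
      refine (Complex.re_le_norm _).trans (le_of_eq ?_)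
      simp [hx]
    have h3 : (0 : ℝ) ≤ ε (deg β) := NNReal.coe_nonneg _
    have h4 : ((ε (deg β) : ℂ) * ((2 * (conj (mono β w) * monoDeriv β w (G w)).re : ℝ) : ℂ)).re =
        ε (deg β) * (2 * (conj (mono β w) * monoDeriv β w (G w)).re) := by
      rw [Complex.re_ofReal_mul, Complex.ofReal_re]
    rw [h4, hGw, map_add, mul_add, Complex.add_re]
    have h5 := mul_le_mul_of_nonneg_left (add_le_add h1 h2) h3
    simp only [hy, hB, hE, hx]
    simp only [hx] at h5
    push_cast at h5 ⊢
    linarith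

end SingleField

variable {n m : ℕ}

/-! ### Switched trajectories and forward invariance. -/

theorem HasMonoSeries.lipschitzOnWith {F : (Fin n → ℂ) → Fin n → ℂ} {s r : ℝ}
    {a : Fin n → (Fin n → ℕ) → ℂ} (h : ∀ l, HasMonoSeries s (fun z => F z l) (a l))
    (hr : r < s) : ∃ K : ℝ≥0, LipschitzOnWith K F (Metric.ball 0 r) := by
  have hl : ∀ l, ∃ K : ℝ≥0, LipschitzOnWith K (fun z => F z l) (Metric.ball 0 r) := fun l => by
    obtain ⟨C, hC⟩ := (h l).hasFDerivAt hr
    choose! f' h1 h2 _ using hC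
    exact ⟨C, (convex_ball _ _).lipschitzOnWith_of_nnnorm_hasFDerivWithin_le
      (fun w hw => (h1 w hw).hasFDerivWithinAt) h2⟩
  choose K hK using hl
  refine ⟨∑ l, K l, LipschitzOnWith.of_dist_le_mul fun x hx y hy => ?_⟩
  refine (dist_pi_le_iff (by positivity)).2 fun l => ((hK l).dist_le_mul x hx y hy).trans ?_
  gcongr
  exact Finset.single_le_sum (fun _ _ => zero_le) (Finset.mem_univ l)

theorem HasMonoSeries.continuousOn {F : (Fin n → ℂ) → Fin n → ℂ} {s : ℝ}
    {a : Fin n → (Fin n → ℕ) → ℂ} (h : ∀ l, HasMonoSeries s (fun z => F z l) (a l)) :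
    ContinuousOn F (Metric.ball 0 s) := fun _ hz =>
  (continuousAt_pi.2 fun l => ((h l).differentiableAt hz).continuousAt).continuousWithinAt

section CommutationLaw

variable {σ : ℝ → Fin m}

/-- The discontinuities in `(0, t + 1]` other than `t` form a finite, hence closed, set that misses
`t`. -/
theorem SwitchedKoopman.IsCommutationLaw.exists_forall_continuousAt (hσ : IsCommutationLaw σ)
    (t : ℝ) : ∃ δ > 0, ∀ s, 0 < s → dist s t < δ → s ≠ t → ContinuousAt σ s := by
  have hfin := (hσ (t + 1)).subset (sdiff_subset (t := {t}))
  have hmem : ({s : ℝ | 0 < s ∧ s ≤ t + 1 ∧ ¬ ContinuousAt σ s} \ {t})ᶜ ∈ 𝓝 t :=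
    hfin.isClosed.isOpen_compl.mem_nhds fun h => h.2 rfl
  obtain ⟨δ, hδ, hball⟩ := Metric.mem_nhds_iff.1 hmem
  refine ⟨min δ 1, lt_min hδ one_pos, fun s hs hst hne => ?_⟩
  by_contra hc
  have h1 : s < t + 1 := by
    have := (le_abs_self _).trans_lt (hst.trans_le (min_le_right _ _))
    linarith
  exact hball (Metric.mem_ball.2 (hst.trans_le (min_le_left _ _))) ⟨⟨hs, h1.le, hc⟩, hne⟩

theorem exists_eqOn_const_Ioo {a b : ℝ} (hab : a < b)
    (h : ∀ s ∈ Ioo a b, ContinuousAt σ s) : ∃ i, ∀ s ∈ Ioo a b, σ s = i := by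
  obtain ⟨c, hc⟩ := nonempty_Ioo.2 hab
  exact ⟨σ c, fun s hs => isPreconnected_Ioo.constant
    (fun s hs => (h s hs).continuousWithinAt) hs hc⟩

theorem SwitchedKoopman.IsCommutationLaw.exists_right (hσ : IsCommutationLaw σ) {t : ℝ}
    (ht : 0 ≤ t) : ∃ b > t, ∃ i, ∀ s ∈ Ioo t b, ContinuousAt σ s ∧ σ s = i := by
  obtain ⟨δ, hδ, h⟩ := hσ.exists_forall_continuousAt t
  have hcont : ∀ s ∈ Ioo t (t + δ), ContinuousAt σ s := fun s hs =>
    h s (ht.trans_lt hs.1) (by rw [Real.dist_eq, abs_of_pos] <;> linarith [hs.1, hs.2]) hs.1.ne'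
  obtain ⟨i, hi⟩ := exists_eqOn_const_Ioo (by linarith) hcont
  exact ⟨t + δ, by linarith, i, fun s hs => ⟨hcont s hs, hi s hs⟩⟩

theorem SwitchedKoopman.IsCommutationLaw.exists_left (hσ : IsCommutationLaw σ) {t : ℝ}
    (ht : 0 < t) : ∃ a, 0 ≤ a ∧ a < t ∧ ∃ i, ∀ s ∈ Ioo a t, ContinuousAt σ s ∧ σ s = i := by
  obtain ⟨δ, hδ, h⟩ := hσ.exists_forall_continuousAt t
  have hcont : ∀ s ∈ Ioo (max 0 (t - δ)) t, ContinuousAt σ s := fun s hs => by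
    have h1 := max_lt_iff.1 hs.1
    exact h s h1.1 (by rw [Real.dist_eq, abs_of_neg] <;> linarith [hs.2]) hs.2.ne
  have hlt : max 0 (t - δ) < t := max_lt ht (by linarith)
  obtain ⟨i, hi⟩ := exists_eqOn_const_Ioo hlt hcont
  exact ⟨_, le_max_left _ _, hlt, i, fun s hs => ⟨hcont s hs, hi s hs⟩⟩

end CommutationLaw

section Trajectory

variable {F : Fin m → (Fin n → ℂ) → Fin n → ℂ} {X : Set (Fin n → ℂ)} {σ : ℝ → Fin m}
  {x : ℝ → Fin n → ℂ}

/-- At `a` itself `σ` may jump and the equation is not assumed. The right derivative is recovered as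
the limit of the derivatives on `(a, b)`. -/
theorem SwitchedKoopman.IsTrajectory.hasDerivWithinAt_Ici (hF : ∀ i, ContinuousOn (F i) X)
    (hx : IsTrajectory F X σ x) {a b : ℝ} (ha : 0 ≤ a) (hab : a < b) {i : Fin m}
    (hi : ∀ s ∈ Ioo a b, ContinuousAt σ s ∧ σ s = i) :
    HasDerivWithinAt x (F i (x a)) (Ici a) a := by
  have hd : ∀ s ∈ Ioo a b, HasDerivAt x (F i (x s)) s := fun s hs => by
    have := hx.hasDerivAt s (ha.trans_lt hs.1) (hi s hs).1
    rwa [(hi s hs).2] at this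
  have hmem : Ioo a b ∈ 𝓝[>] a := Ioo_mem_nhdsGT hab
  have hcont : ContinuousWithinAt x (Ioo a b) a :=
    (hx.continuousOn a ha).mono fun s hs => ha.trans hs.1.le
  refine hasDerivWithinAt_Ici_of_tendsto_deriv
    (fun s hs => (hd s hs).differentiableAt.differentiableWithinAt) hcont hmem ?_
  have h1 : Tendsto (fun s => F i (x s)) (𝓝[Ioo a b] a) (𝓝 (F i (x a))) :=
    ((hF i (x a) (hx.mem a ha)).tendsto.comp
      (tendsto_nhdsWithin_iff.2 ⟨hcont.tendsto, by
        filter_upwards [self_mem_nhdsWithin] with s hs using hx.mem s (ha.trans hs.1.le)⟩))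
  rw [nhdsWithin_Ioo_eq_nhdsGT hab] at h1
  refine h1.congr' ?_
  filter_upwards [hmem] with s hs using (hd s hs).deriv.symm

theorem exists_norm_lt_of_continuousOn_Icc {x : ℝ → Fin n → ℂ} {a b s : ℝ} (hab : a ≤ b)
    (hx : ContinuousOn x (Icc a b)) (hs : ∀ t ∈ Icc a b, ‖x t‖ < s) :
    ∃ r < s, ∀ t ∈ Icc a b, ‖x t‖ < r := by
  obtain ⟨t, ht, hmax⟩ := isCompact_Icc.exists_isMaxOn (nonempty_Icc.2 hab) hx.norm
  obtain ⟨r, h1, h2⟩ := exists_between (hs t ht)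
  exact ⟨r, h2, fun u hu => (hmax hu).trans_lt h1⟩

/-- Between two switching times a trajectory follows the flow of the active vector field. -/
theorem SwitchedKoopman.IsTrajectory.eq_flow {α : Fin m → Fin n → (Fin n → ℕ) → ℂ}
    (hF : ∀ i l, HasMonoSeries 1 (fun z => F i z l) (α i l))
    (hx : IsTrajectory F (Metric.ball 0 1) σ x) {i : Fin m} {φ : ℝ → (Fin n → ℂ) → Fin n → ℂ}
    (hφ : IsHolomorphicFlow (F i) (Metric.ball 0 1) φ)
    {a b : ℝ} (ha : 0 ≤ a) (hab : a < b)
    (hi : ∀ s ∈ Ioo a b, ContinuousAt σ s ∧ σ s = i) : x b = φ (b - a) (x a) := by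
  have hxa := hx.mem a ha
  have hshift : ∀ t ∈ Icc a b,
      HasDerivWithinAt (fun s => φ (s - a) (x a)) (F i (φ (t - a) (x a))) (Ici a) t := fun t ht => by
    have h1 := hφ.hasDerivWithinAt (x a) hxa (t - a) (by linarith [ht.1])
    have h2 : HasDerivWithinAt (fun s : ℝ => s - a) 1 (Ici a) t :=
      (hasDerivWithinAt_id t _).sub_const a
    have h3 := h1.scomp t h2 fun s (hs : a ≤ s) => sub_nonneg.2 hs
    rw [one_smul] at h3
    exact h3
  have hxc : ContinuousOn x (Icc a b) := hx.continuousOn.mono fun s hs => ha.trans hs.1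
  have hφc : ContinuousOn (fun s => φ (s - a) (x a)) (Icc a b) := fun t ht =>
    (hshift t ht).continuousWithinAt.mono Icc_subset_Ici_self
  -- A Lipschitz bound is available only on balls of radius less than 1. Compactness of `[a, b]`
  -- keeps both curves in such a ball, as uniqueness requires.
  obtain ⟨r1, hr1, h1⟩ := exists_norm_lt_of_continuousOn_Icc hab.le hxc
    fun t ht => mem_ball_zero_iff.1 (hx.mem t (ha.trans ht.1))
  obtain ⟨r2, hr2, h2⟩ := exists_norm_lt_of_continuousOn_Icc hab.le hφc
    fun t ht => mem_ball_zero_iff.1 (hφ.mapsTo (t - a) (by linarith [ht.1]) hxa)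
  obtain ⟨K, hK⟩ := HasMonoSeries.lipschitzOnWith (hF i) (max_lt hr1 hr2)
  refine ODE_solution_unique_of_mem_Icc_right (v := fun _ => F i)
    (s := fun _ => Metric.ball 0 (max r1 r2)) (K := K) (fun _ _ => hK) hxc ?_ ?_ hφc ?_ ?_ ?_
    (right_mem_Icc.2 hab.le)
  · intro t ht
    rcases ht.1.eq_or_lt with rfl | hat
    · exact hx.hasDerivWithinAt_Ici (fun i => HasMonoSeries.continuousOn (hF i)) ha hab hi
    · have := hx.hasDerivAt t (ha.trans_lt hat) (hi t ⟨hat, ht.2⟩).1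
      rw [(hi t ⟨hat, ht.2⟩).2] at this
      exact this.hasDerivWithinAt
  · exact fun t ht => mem_ball_zero_iff.2 ((h1 t (Ico_subset_Icc_self ht)).trans_le (le_max_left _ _))
  · exact fun t ht => (hshift t (Ico_subset_Icc_self ht)).mono (Ici_subset_Ici.2 ht.1)
  · exact fun t ht => mem_ball_zero_iff.2 ((h2 t (Ico_subset_Icc_self ht)).trans_le (le_max_right _ _))
  · simp [hφ.map_zero _ hxa]

/-- An open set that is forward invariant for all flows is forward invariant for the switched
system. -/
theorem SwitchedKoopman.IsTrajectory.mem_of_isForwardInvariant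
    {α : Fin m → Fin n → (Fin n → ℕ) → ℂ}
    (hF : ∀ i l, HasMonoSeries 1 (fun z => F i z l) (α i l)) (hσ : IsCommutationLaw σ)
    (hx : IsTrajectory F (Metric.ball 0 1) σ x) {φ : Fin m → ℝ → (Fin n → ℂ) → Fin n → ℂ}
    (hφ : ∀ i, IsHolomorphicFlow (F i) (Metric.ball 0 1) (φ i)) {U : Set (Fin n → ℂ)}
    (hU : IsOpen U) (hinv : ∀ i, IsForwardInvariant (φ i) U) (h0 : x 0 ∈ U) {t : ℝ} (ht : 0 ≤ t) :
    x t ∈ U := by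
  by_contra hc
  -- Since `U` is open, the times spent outside `U` form a closed set, so there is a first one. Just
  -- before it the trajectory lies in `U` and follows a single flow up to that time, a
  -- contradiction.
  set A : Set ℝ := Ici 0 ∩ x ⁻¹' Uᶜ with hA
  have hAc : IsClosed A := hx.continuousOn.preimage_isClosed_of_isClosed isClosed_Ici
    hU.isClosed_compl
  have hbdd : BddBelow A := ⟨0, fun s hs => hs.1⟩
  have hmem : sInf A ∈ A := hAc.csInf_mem ⟨t, ht, hc⟩ hbdd
  have hpos : 0 < sInf A := by
    refine lt_of_le_of_ne hmem.1 fun h => hmem.2 ?_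
    rwa [← h]
  obtain ⟨a, ha, hat, i, hi⟩ := hσ.exists_left hpos
  have hxa : x a ∈ U := by
    by_contra hxa
    exact hat.not_ge (csInf_le hbdd ⟨ha, hxa⟩)
  refine hmem.2 ?_
  rw [hx.eq_flow hF (hφ i) ha hat hi]
  exact hinv i (by linarith) hxa

end Trajectory

/-- A scalar differential inequality for right derivatives. -/
theorem le_exp_mul_of_hasDerivWithinAt {V : ℝ → ℝ} {c : ℝ} (hV : ContinuousOn V (Ici 0))
    (hd : ∀ t, 0 ≤ t → ∃ V', HasDerivWithinAt V V' (Ici t) t ∧ V' ≤ -c * V t) {t : ℝ}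
    (ht : 0 ≤ t) : V t ≤ Real.exp (-c * t) * V 0 := by
  choose! V' h1 h2 using hd
  have hexp : ∀ s, HasDerivAt (fun s => Real.exp (c * s)) (Real.exp (c * s) * c) s := fun s => by
    simpa using ((hasDerivAt_id s).const_mul c).exp
  -- The function `e^{cs} V(s)` has nonpositive right derivative, so it stays below its initial
  -- value.
  have := image_le_of_deriv_right_le_deriv_boundary (a := 0) (b := t)
    (f := fun s => Real.exp (c * s) * V s)
    (f' := fun s => Real.exp (c * s) * c * V s + Real.exp (c * s) * V' s)
    (B := fun _ => V 0) (B' := fun _ => 0)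
    ((by fun_prop : Continuous fun s => Real.exp (c * s)).continuousOn.mul
      (hV.mono fun s hs => hs.1))
    (fun s hs => (hexp s).hasDerivWithinAt.mul (h1 s hs.1)) (by simp) continuousOn_const
    (fun s _ => hasDerivWithinAt_const _ _ _)
    (fun s hs => by
      have h3 := mul_le_mul_of_nonneg_left (h2 s hs.1) (Real.exp_pos (c * s)).le
      linarith) (right_mem_Icc.2 ht)
  calc V t = Real.exp (-c * t) * (Real.exp (c * t) * V t) := by
        rw [← mul_assoc, ← Real.exp_add]
        simp
    _ ≤ _ := by gcongr

theorem exists_pos_le_of_finite {ι : Type*} [Finite ι] {f : ι → ℝ} (hf : ∀ i, 0 < f i) :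
    ∃ s > 0, ∀ i, s ≤ f i := by
  have h : ∀ᶠ s in 𝓝[>] (0 : ℝ), ∀ i, s ≤ f i :=
    eventually_all.2 fun i => by
      filter_upwards [Ioo_mem_nhdsGT (hf i)] with s hs using hs.2.le
  obtain ⟨s, hs, h⟩ := (h.and self_mem_nhdsWithin).exists
  exact ⟨s, h, hs⟩

/-! ### The vector field in triangularizing coordinates. -/

/-- The components of a vector field with summable Taylor series, in linear coordinates, are
sums of monomial series near `0`. -/
theorem exists_hasMonoSeries_changeCoord {F : (Fin n → ℂ) → Fin n → ℂ}
    (hF : ∀ l, HasSummableTaylor fun z => F z l) (P : Matrix (Fin n) (Fin n) ℂ) :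
    ∃ s > 0, ∃ b : Fin n → (Fin n → ℕ) → ℂ,
      ∀ l, HasMonoSeries s (fun w => changeCoord P F w l) (b l) := by
  choose s hs b hb using fun k => (hF k).exists_hasMonoSeries_comp P
  obtain ⟨r, hr, hrs⟩ := exists_pos_le_of_finite hs
  exact ⟨r, hr, fun l β => ∑ k, P⁻¹ l k * b k β, fun l =>
    HasMonoSeries.sum Finset.univ fun k _ => ((hb k).mono_radius (hrs k)).const_mul (P⁻¹ l k)⟩

theorem HasMonoSeries.jacobian_apply {G : (Fin n → ℂ) → Fin n → ℂ} {s : ℝ} (hs : 0 < s)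
    {b : Fin n → (Fin n → ℕ) → ℂ} (h : ∀ l, HasMonoSeries s (fun w => G w l) (b l))
    (l r : Fin n) : jacobian G 0 l r = b l (Pi.single r 1) := by
  have h0 : (0 : Fin n → ℂ) ∈ Metric.ball (0 : Fin n → ℂ) s := Metric.mem_ball_self hs
  have hd : DifferentiableAt ℂ G 0 := differentiableAt_pi.2 fun j => (h j).differentiableAt h0
  rw [← (h l).coeff_single hs, (hasFDerivAt_pi'.1 hd.hasFDerivAt l).fderiv, jacobian,
    LinearMap.toMatrix'_apply]
  rfl

theorem jacobian_changeCoord {F : (Fin n → ℂ) → Fin n → ℂ} (hF : DifferentiableAt ℂ F 0)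
    (P : Matrix (Fin n) (Fin n) ℂ) :
    jacobian (changeCoord P F) 0 = P⁻¹ * jacobian F 0 * P := by
  have h1 : HasFDerivAt (changeCoord P F) ((Matrix.toLin' P⁻¹).toContinuousLinearMap.comp
      ((fderiv ℂ F 0).comp (Matrix.toLin' P).toContinuousLinearMap)) 0 := by
    have hP := (Matrix.toLin' P).toContinuousLinearMap.hasFDerivAt (x := (0 : Fin n → ℂ))
    have hF' : HasFDerivAt F (fderiv ℂ F 0) ((Matrix.toLin' P).toContinuousLinearMap 0) := by
      rw [map_zero]
      exact hF.hasFDerivAt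
    exact ((Matrix.toLin' P⁻¹).toContinuousLinearMap.hasFDerivAt).comp 0 (hF'.comp 0 hP)
  rw [jacobian, h1.fderiv]
  have : (((Matrix.toLin' P⁻¹).toContinuousLinearMap.comp
      ((fderiv ℂ F 0).comp (Matrix.toLin' P).toContinuousLinearMap) :
      (Fin n → ℂ) →L[ℂ] (Fin n → ℂ)) : (Fin n → ℂ) →ₗ[ℂ] (Fin n → ℂ)) =
      (Matrix.toLin' P⁻¹).comp ((fderiv ℂ F 0 : (Fin n → ℂ) →ₗ[ℂ] (Fin n → ℂ)).comp
        (Matrix.toLin' P)) := rfl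
  rw [this, LinearMap.toMatrix'_comp, LinearMap.toMatrix'_comp, LinearMap.toMatrix'_toLin',
    LinearMap.toMatrix'_toLin', jacobian, mul_assoc]

/-- A diagonal entry of a triangular matrix is an eigenvalue. -/
theorem Matrix.BlockTriangular.mem_spectrum_diag {T : Matrix (Fin n) (Fin n) ℂ}
    (hT : T.BlockTriangular id) (l : Fin n) : T l l ∈ spectrum ℂ T := by
  rw [spectrum.mem_iff, Matrix.isUnit_iff_isUnit_det, Matrix.det_of_isUpperTriangular,
    Finset.prod_eq_zero (Finset.mem_univ l)]
  · simp
  · simp [Matrix.algebraMap_matrix_apply]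
  · intro i j hij
    have : i ≠ j := (show j < i from hij).ne'
    simp [Matrix.algebraMap_matrix_apply, hT hij, this]

theorem spectrum_inv_mul_mul {P : Matrix (Fin n) (Fin n) ℂ} (hP : IsUnit P.det)
    (A : Matrix (Fin n) (Fin n) ℂ) : spectrum ℂ (P⁻¹ * A * P) = spectrum ℂ A := by
  obtain ⟨u, hu⟩ := (Matrix.isUnit_iff_isUnit_det P).2 hP
  have : P⁻¹ = ((u⁻¹ : (Matrix (Fin n) (Fin n) ℂ)ˣ) : Matrix (Fin n) (Fin n) ℂ) := by
    rw [← hu, Matrix.coe_units_inv]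
  rw [this, ← hu]
  exact spectrum.units_conjugate' (R := ℂ) (a := A) (u := u)

theorem hasMonoSeries_tsum {b : (Fin n → ℕ) → ℂ} (hb : ∑' η, ‖b η‖ₑ ≠ ⊤) :
    HasMonoSeries 1 (fun w => ∑' η, b η * mono η w) b := fun w hw => by
  refine Summable.hasSum (Summable.of_enorm (ne_top_of_le_ne_top hb ?_))
  refine ENNReal.tsum_le_tsum fun η => ?_
  rw [enorm_mul]
  refine mul_le_of_le_one_right' ?_
  simpa using enorm_mono_le η (s := 1) (mem_ball_zero_iff.1 hw).le

/-- Identity theorem: a power series around `0` represents a function, holomorphic along complex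
lines through `0`, as far as both make sense. -/
theorem HasMonoSeries.eq_of_differentiableOn {f g : (Fin n → ℂ) → ℂ} {s R : ℝ} (hs : 0 < s)
    {b : (Fin n → ℕ) → ℂ} (hf : HasMonoSeries s f b) (hg : HasMonoSeries R g b)
    {w : Fin n → ℂ} {r : ℝ} (hr : 1 < r) (hw : ∀ τ ∈ Metric.ball (0 : ℂ) r, ‖τ • w‖ < R)
    (hfd : DifferentiableOn ℂ (fun τ : ℂ => f (τ • w)) (Metric.ball 0 r)) : f w = g w := by
  have hgd : DifferentiableOn ℂ (fun τ : ℂ => g (τ • w)) (Metric.ball 0 r) := fun τ hτ => by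
    have h1 := (hg.differentiableAt (mem_ball_zero_iff.2 (hw τ hτ)))
    exact (h1.comp τ (f := fun τ : ℂ => τ • w) (by fun_prop)).differentiableWithinAt
  have hR : 0 < R := (norm_nonneg _).trans_lt (hw 0 (Metric.mem_ball_self (by linarith)))
  have hev : (fun τ : ℂ => f (τ • w)) =ᶠ[𝓝 0] fun τ => g (τ • w) := by
    have hc : Tendsto (fun τ : ℂ => τ • w) (𝓝 0) (𝓝 0) := by
      have : Continuous fun τ : ℂ => τ • w := by fun_prop
      simpa using this.tendsto 0
    filter_upwards [hc (Metric.ball_mem_nhds 0 hs), hc (Metric.ball_mem_nhds 0 hR)] with τ h1 h2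
    exact (hf _ h1).unique (hg _ h2)
  have h := (hfd.analyticOnNhd Metric.isOpen_ball).eqOn_of_preconnected_of_eventuallyEq
    (hgd.analyticOnNhd Metric.isOpen_ball) (convex_ball (0 : ℂ) r).isPreconnected
    (Metric.mem_ball_self (by linarith)) hev
  simpa using h (show (1 : ℂ) ∈ Metric.ball 0 r by simpa using hr)

theorem exists_one_lt_forall_norm_smul_lt {v : Fin n → ℂ} (hv : ‖v‖ < 1) :
    ∃ r > 1, ∀ τ ∈ Metric.ball (0 : ℂ) r, ‖τ • v‖ < 1 := by
  have h : ∀ᶠ r in 𝓝[>] (1 : ℝ), r * ‖v‖ < 1 := by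
    have : Continuous fun r : ℝ => r * ‖v‖ := by fun_prop
    exact nhdsWithin_le_nhds (this.tendsto 1 (Iio_mem_nhds (by simpa using hv)))
  obtain ⟨r, h1, h2⟩ := (h.and self_mem_nhdsWithin).exists
  refine ⟨r, h2, fun τ hτ => ?_⟩
  rw [norm_smul]
  refine lt_of_le_of_lt ?_ h1
  gcongr
  exact (mem_ball_zero_iff.1 hτ).le

/-- The point `P w` may leave the unit polydisk, where nothing is known of `F`, so the comparison is
limited to `‖w‖ < 1` and `‖P w‖ < 1`. Both conditions persist for `τ • w` with `|τ|` slightly above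
1, so the identity theorem on this complex line reaches `τ = 1`. -/
theorem changeCoord_eq_tsum {F : (Fin n → ℂ) → Fin n → ℂ}
    (hF : ∀ z ∈ Metric.ball (0 : Fin n → ℂ) 1, DifferentiableAt ℂ F z)
    {P : Matrix (Fin n) (Fin n) ℂ} {s : ℝ} (hs : 0 < s) {b : Fin n → (Fin n → ℕ) → ℂ}
    (hG : ∀ l, HasMonoSeries s (fun w => changeCoord P F w l) (b l))
    (hb : ∀ l, ∑' η, ‖b l η‖ₑ ≠ ⊤) {w : Fin n → ℂ} (hw : ‖w‖ < 1) (hPw : ‖P.mulVec w‖ < 1) :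
    changeCoord P F w = fun l => ∑' η, b l η * mono η w := by
  obtain ⟨r1, hr1, h1⟩ := exists_one_lt_forall_norm_smul_lt hw
  obtain ⟨r2, hr2, h2⟩ := exists_one_lt_forall_norm_smul_lt hPw
  funext l
  refine (hG l).eq_of_differentiableOn hs (hasMonoSeries_tsum (hb l)) (lt_min hr1 hr2)
    (fun τ hτ => h1 τ (Metric.ball_subset_ball (min_le_left _ _) hτ)) fun τ hτ => ?_
  have h3 := hF (P.mulVec (τ • w)) (by
    rw [Matrix.mulVec_smul, mem_ball_zero_iff]
    exact h2 τ (Metric.ball_subset_ball (min_le_right _ _) hτ))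
  have h4 : DifferentiableAt ℂ (fun τ : ℂ => P.mulVec (τ • w)) τ := by
    simp_rw [Matrix.mulVec_smul]
    fun_prop
  have h5 := ((Matrix.toLin' P⁻¹).toContinuousLinearMap.differentiableAt).comp τ (h3.comp τ h4)
  exact (differentiableAt_pi.1 h5 l).differentiableWithinAt

theorem summable_pow_deg {t : ℝ} (ht : 0 ≤ t) (ht1 : t < 1) (n : ℕ) :
    Summable fun β : Fin n → ℕ => t ^ deg β := by
  induction n with
  | zero => exact (hasSum_fintype _).summable
  | succ n ih =>
    rw [← (Fin.consEquiv fun _ : Fin (n + 1) => ℕ).summable_iff]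
    refine ((summable_geometric_of_lt_one ht ht1).mul_of_nonneg ih (fun _ => by positivity)
      fun _ => by positivity).congr fun p => ?_
    simp [deg, Fin.sum_univ_succ, pow_add]

/-! ### Consequences of the limsup condition. -/

section Koopman

variable {G : (Fin n → ℂ) → Fin n → ℂ} {s : ℝ} {b : Fin n → (Fin n → ℕ) → ℂ}

/-- Leaving out the constant monomial loses nothing: the degree cannot drop to zero, and the row of
the constant monomial vanishes. -/
theorem koopmanRowSum_eq (hs : 0 < s) (hG : ∀ l, HasMonoSeries s (fun w => G w l) (b l))
    (hb : ∀ l, b l 0 = 0) (β : Fin n → ℕ) :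
    koopmanRowSum G β = ∑' γ, ‖koopmanCoeff b β γ‖ₑ := by
  simp_rw [koopmanRowSum, koopmanEntry_eq hs hG]
  refine tsum_subtype_eq_of_support_subset (s := {γ | γ ≠ 0})
    (f := fun γ => ‖koopmanCoeff b β γ‖ₑ) fun γ hγ h0 => ?_
  have h1 := enorm_ne_zero.1 hγ
  have h2 := deg_le_of_koopmanCoeff_ne_zero hb h1
  rw [h0, deg_eq_zero.2 rfl, Nat.le_zero, deg_eq_zero] at h2
  exact h1 (by rw [h2, koopmanCoeff_zero_left])

theorem koopmanColSum_eq (hs : 0 < s) (hG : ∀ l, HasMonoSeries s (fun w => G w l) (b l))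
    (γ : Fin n → ℕ) : koopmanColSum G γ = ∑' β, ‖koopmanCoeff b β γ‖ₑ := by
  simp_rw [koopmanColSum, koopmanEntry_eq hs hG]
  refine tsum_subtype_eq_of_support_subset (s := {β | β ≠ 0})
    (f := fun β => ‖koopmanCoeff b β γ‖ₑ) fun β hβ h0 => ?_
  exact enorm_ne_zero.1 hβ (by rw [h0, koopmanCoeff_zero_left])

/-- The condition on the limit superior bounds the quotients for all monomials of large degree. -/
theorem exists_koopmanRatio_lt {κ : ℝ} {q : ℝ≥0∞} (h : koopmanLimsup κ G < q) :
    ∃ d : ℕ, ∀ β γ : Fin n → ℕ, d < deg γ → β ≠ 0 → deg β < deg γ → koopmanEntry G β γ ≠ 0 →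
      koopmanRatio κ G β γ < q := by
  have hev := eventually_lt_of_limsup_lt h
  rw [eventually_cofinite] at hev
  obtain ⟨d, hd⟩ := (hev.image deg).bddAbove
  refine ⟨d, fun β γ hγ hβ hlt hne => ?_⟩
  have h1 : ¬ ¬ _ := fun hc => hγ.not_ge (hd (mem_image_of_mem deg hc))
  refine lt_of_le_of_lt ?_ (not_not.1 h1)
  exact le_iSup_of_le β (le_iSup_of_le hβ (le_iSup_of_le (Or.inl hlt) (le_iSup_of_le hne le_rfl)))

/-- The condition on the limit superior forces the Taylor coefficients to be absolutely
summable. -/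
theorem tsum_enorm_coeff_ne_top (hs : 0 < s)
    (hG : ∀ l, HasMonoSeries s (fun w => G w l) (b l)) (hb : ∀ l, b l 0 = 0) {κ : ℝ} {q : ℝ≥0∞}
    (h : koopmanLimsup κ G < q) (l : Fin n) : ∑' η, ‖b l η‖ₑ ≠ ⊤ := by
  obtain ⟨d, hd⟩ := exists_koopmanRatio_lt h
  -- Either `b l` has finitely many nonzero coefficients, or one of large degree `γ` is nonzero. The
  -- row of the monomial `z_l` is `b l` itself and column `γ` is nonzero, so a finite ratio excludes
  -- an infinite row sum. The `1` in `max d 1` ensures that `γ` has larger degree than `z_l`.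
  by_cases hsupp : ∀ γ, b l γ ≠ 0 → deg γ ≤ max d 1
  · rw [tsum_eq_sum (s := (finite_deg_le (n := n) (max d 1)).toFinset)]
    · exact ENNReal.sum_ne_top.2 fun _ _ => enorm_ne_top
    · intro γ hγ
      by_contra hc
      exact hγ (by simpa using hsupp γ (enorm_ne_zero.1 hc))
  · push Not at hsupp
    obtain ⟨γ, hγ, hdγ⟩ := hsupp
    have hβ : (Pi.single l 1 : Fin n → ℕ) ≠ 0 := fun h0 => by
      have := congrFun h0 l
      simp at this
    have hK : koopmanCoeff b (Pi.single l 1) γ ≠ 0 := by rwa [koopmanCoeff_single]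
    have hlt := hd (Pi.single l 1) γ ((le_max_left _ _).trans_lt hdγ) hβ
      (by rw [deg_single]; exact (le_max_right _ _).trans_lt hdγ)
      (by rwa [koopmanEntry_eq hs hG])
    have hrow := koopmanRowSum_eq hs hG hb (Pi.single l 1)
    simp_rw [koopmanCoeff_single] at hrow
    rw [← hrow]
    intro htop
    have hcol : koopmanColSum G γ ≠ 0 := by
      rw [koopmanColSum_eq hs hG]
      exact fun h0 => enorm_ne_zero.2 hK (ENNReal.tsum_eq_zero.1 h0 _)
    rw [koopmanRatio, htop, ENNReal.mul_top hcol, ENNReal.top_div_of_ne_top ENNReal.ofReal_ne_top]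
      at hlt
    exact not_top_lt hlt

end Koopman

theorem diagWeight_pos {d : Fin n → ℝ≥0} (hd : ∀ l, 0 < d l) {β : Fin n → ℕ} (hβ : β ≠ 0) :
    0 < diagWeight d β := by
  obtain ⟨l, hl⟩ := Function.ne_iff.1 hβ
  have h1 : (0 : ℝ≥0) < β l := by exact_mod_cast Nat.pos_of_ne_zero hl
  exact (mul_pos h1 (hd l)).trans_le (mul_le_diagWeight d β l)

/-- What the hypotheses of the theorem say about one vector field, in terms of its Taylor
coefficients in the triangularizing coordinates. -/
theorem exists_koopman_data {F : (Fin n → ℂ) → Fin n → ℂ}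
    (hF : ∀ l, HasSummableTaylor fun z => F z l)
    (hFd : ∀ z ∈ Metric.ball (0 : Fin n → ℂ) 1, DifferentiableAt ℂ F z)
    (hhyp : IsHyperbolicStableAtZero F) {P : Matrix (Fin n) (Fin n) ℂ} (hP : IsUnit P.det)
    (htri : (P⁻¹ * jacobian F 0 * P).BlockTriangular id) {κ q : ℝ≥0} (hκ : 0 < κ)
    (hlim : koopmanLimsup κ (changeCoord P F) < q) :
    ∃ (b : Fin n → (Fin n → ℕ) → ℂ) (d : Fin n → ℝ≥0) (R C : (Fin n → ℕ) → ℝ≥0) (k₀ : ℕ),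
      (∀ l, b l 0 = 0) ∧
      (∀ l, HasMonoSeries 1 (fun w => ∑' η, b l η * mono η w) (b l)) ∧
      (∀ w, ‖w‖ < 1 → ‖P.mulVec w‖ < 1 →
        changeCoord P F w = fun l => ∑' η, b l η * mono η w) ∧
      (∀ l r, b l (Pi.single r 1) = jacobian (changeCoord P F) 0 l r) ∧
      (jacobian (changeCoord P F) 0).BlockTriangular id ∧
      (∀ l, 0 < d l) ∧ (∀ l, (jacobian (changeCoord P F) 0 l l).re = -(d l : ℝ)) ∧
      (∀ β, ∑' γ, ‖koopmanCoeff b β γ‖ₑ ≤ R β) ∧ (∀ γ, ∑' β, ‖koopmanCoeff b β γ‖ₑ ≤ C γ) ∧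
      ∀ β γ, k₀ < deg γ → β ≠ 0 → deg β < deg γ → koopmanCoeff b β γ ≠ 0 →
        R β * C γ ≤ κ ^ 2 * (diagWeight d β * diagWeight d γ) * q := by
  obtain ⟨s, hs, b, hG⟩ := exists_hasMonoSeries_changeCoord hF P
  have hb : ∀ l, b l 0 = 0 := fun l => by
    rw [← (hG l).apply_zero hs, changeCoord, Matrix.mulVec_zero, hhyp.1, Matrix.mulVec_zero]
    rfl
  have hbs := tsum_enorm_coeff_ne_top hs hG hb hlim
  have hbJ : ∀ l r, b l (Pi.single r 1) = jacobian (changeCoord P F) 0 l r := fun l r =>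
    (HasMonoSeries.jacobian_apply hs hG l r).symm
  have hJ := jacobian_changeCoord (hFd 0 (Metric.mem_ball_self one_pos)) P
  have hT : (jacobian (changeCoord P F) 0).BlockTriangular id := hJ ▸ htri
  have hneg : ∀ l, (jacobian (changeCoord P F) 0 l l).re < 0 := fun l => by
    refine hhyp.2 _ ?_
    rw [← spectrum_inv_mul_mul hP, ← hJ]
    exact hT.mem_spectrum_diag l
  obtain ⟨d, hd⟩ : ∃ d : Fin n → ℝ≥0,
      ∀ l, (jacobian (changeCoord P F) 0 l l).re = -(d l : ℝ) :=
    ⟨fun l => ⟨-(jacobian (changeCoord P F) 0 l l).re, by linarith [hneg l]⟩, fun l => (neg_neg _).symm⟩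
  have hd0 : ∀ l, 0 < d l := fun l => by
    have := hneg l
    rw [hd l] at this
    exact_mod_cast neg_lt_zero.1 this
  have hRne : ∀ β, ∑' γ, ‖koopmanCoeff b β γ‖ₑ ≠ ⊤ := fun β =>
    ne_top_of_le_ne_top (ENNReal.sum_ne_top.2 fun l _ =>
      ENNReal.mul_ne_top (ENNReal.natCast_ne_top _) (hbs l)) (tsum_enorm_koopmanCoeff_row_le b β)
  have hCne := tsum_enorm_koopmanCoeff_col_ne_top hb
  have hdiag : ∀ β, |(koopmanEntry (changeCoord P F) β β).re| = diagWeight d β := fun β => by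
    rw [koopmanEntry_eq hs hG, koopmanCoeff_self, Complex.re_sum]
    have h1 : ∀ l ∈ Finset.univ, ((β l : ℂ) * b l (Pi.single l 1)).re = -((β l * d l : ℝ≥0) : ℝ) := by
      intro l _
      rw [hbJ, ← Complex.ofReal_natCast, Complex.re_ofReal_mul, hd]
      simp
    rw [Finset.sum_congr rfl h1, Finset.sum_neg_distrib, abs_neg, ← NNReal.coe_sum, diagWeight,
      abs_of_nonneg (NNReal.coe_nonneg _)]
  obtain ⟨k₀, hk₀⟩ := exists_koopmanRatio_lt hlim
  refine ⟨b, d, fun β => (∑' γ, ‖koopmanCoeff b β γ‖ₑ).toNNReal,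
    fun γ => (∑' β, ‖koopmanCoeff b β γ‖ₑ).toNNReal, k₀, hb, fun l => hasMonoSeries_tsum (hbs l),
    fun w h1 h2 => changeCoord_eq_tsum hFd hs hG hbs h1 h2, hbJ, hT, hd0, hd,
    fun β => (ENNReal.coe_toNNReal (hRne β)).ge, fun γ => (ENNReal.coe_toNNReal (hCne γ)).ge,
    fun β γ hγ hβ hlt hK => ?_⟩
  have hγ0 : γ ≠ 0 := fun h => by simp [h, deg] at hlt
  have h1 := hk₀ β γ hγ hβ hlt (by rwa [koopmanEntry_eq hs hG])
  rw [koopmanRatio, hdiag, hdiag, koopmanColSum_eq hs hG, koopmanRowSum_eq hs hG hb,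
    ← ENNReal.coe_toNNReal (hRne β), ← ENNReal.coe_toNNReal (hCne γ)] at h1
  have h2 : ENNReal.ofReal ((κ : ℝ) ^ 2 * diagWeight d γ * diagWeight d β) =
      ((κ ^ 2 * diagWeight d γ * diagWeight d β : ℝ≥0) : ℝ≥0∞) := by
    rw [← ENNReal.ofReal_coe_nnreal]
    push_cast
    rfl
  have h3 : κ ^ 2 * diagWeight d γ * diagWeight d β ≠ 0 := by
    have := diagWeight_pos hd0 hβ
    have := diagWeight_pos hd0 hγ0
    positivity
  rw [h2, ← ENNReal.coe_mul, ← ENNReal.coe_div h3, ENNReal.coe_lt_coe,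
    div_lt_iff₀ (pos_iff_ne_zero.2 h3)] at h1
  calc _ = _ := mul_comm _ _
    _ ≤ _ := h1.le
    _ = _ := by ring

/-! ### Weights and convergence of the Lyapunov function. -/

/-- The weights of the Lyapunov function, which depend only on the degree. -/
theorem exists_weights {κ ρ : ℝ≥0} (hκ : 0 < κ) (hρ : 0 < ρ) (hρ1 : ρ ≤ 1)
    {D R C : Fin m → (Fin n → ℕ) → ℝ≥0} (hD : ∀ i β, β ≠ 0 → 0 < D i β)
    {K : Fin m → (Fin n → ℕ) → (Fin n → ℕ) → Prop} {k₀ : Fin m → ℕ}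
    (h : ∀ i β γ, k₀ i < deg γ → β ≠ 0 → deg β < deg γ → K i β γ →
      R i β * C i γ ≤ κ ^ 2 * (D i β * D i γ) * (ρ ^ 2)⁻¹) :
    ∃ (ε : ℕ → ℝ≥0) (M : ℝ≥0), ε 0 = 0 ∧ (∀ k, 0 < k → 0 < ε k) ∧
      (∀ k, ε k ≤ M * (ρ ^ 2)⁻¹ ^ k) ∧
      ∀ i β γ, deg β < deg γ → K i β γ →
        ε (deg β) * (R i β * C i γ) ≤ κ ^ 2 * (D i β * D i γ) * ε (deg γ) := by
  obtain ⟨k₁, hk₁⟩ : ∃ k₁, ∀ i, k₀ i ≤ k₁ := by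
    obtain ⟨k₁, hk₁⟩ := (Set.finite_range k₀).bddAbove
    exact ⟨k₁, fun i => hk₁ (mem_range_self i)⟩
  have hq : 1 ≤ (ρ ^ 2)⁻¹ := (one_le_inv₀ (by positivity)).2 (pow_le_one₀ zero_le hρ1)
  -- Only finitely many pairs have both degrees at most `k₁`, so some constant `A`, possibly large,
  -- bounds their ratios.
  obtain ⟨A, hA1, hA⟩ : ∃ A : ℝ≥0, 1 ≤ A ∧ ∀ i β γ, β ≠ 0 → γ ≠ 0 → deg β ≤ k₁ → deg γ ≤ k₁ →
      R i β * C i γ ≤ κ ^ 2 * (D i β * D i γ) * A := by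
    have hfin := (((Set.finite_univ (α := Fin m)).prod
      ((finite_deg_le (n := n) k₁).prod (finite_deg_le k₁))).image fun p =>
        R p.1 p.2.1 * C p.1 p.2.2 / (κ ^ 2 * (D p.1 p.2.1 * D p.1 p.2.2)))
    obtain ⟨A, hA⟩ := hfin.bddAbove
    refine ⟨max 1 A, le_max_left _ _, fun i β γ hβ hγ h1 h2 => ?_⟩
    have h3 := hA (mem_image_of_mem _ (show (i, β, γ) ∈ _ from ⟨mem_univ _, h1, h2⟩))
    have h4 := hD i β hβ
    have h5 := hD i γ hγ
    rw [div_le_iff₀ (by positivity)] at h3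
    calc _ ≤ _ := h3
      _ ≤ max 1 A * (κ ^ 2 * (D i β * D i γ)) := by gcongr; exact le_max_right _ _
      _ = _ := mul_comm _ _
  -- Each degree step gains `ρ⁻²`, and an extra factor `A` up to degree `k₁`; capping the exponent
  -- of `A` keeps the growth rate at `ρ⁻²`. The constant monomial gets weight 0: it has no decay,
  -- and the Lyapunov function must vanish at the origin.
  refine ⟨fun k => if k = 0 then 0 else A ^ min k k₁ * (ρ ^ 2)⁻¹ ^ k, A ^ k₁, by simp,
    fun k hk => ?_, fun k => ?_, fun i β γ hlt hK => ?_⟩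
  · beta_reduce
    rw [if_neg hk.ne']
    have : 0 < A := zero_lt_one.trans_le hA1
    positivity
  · beta_reduce
    split_ifs
    · exact zero_le
    · gcongr
      exact min_le_right _ _
  · by_cases hβ : deg β = 0
    · simp [hβ]
    have hγ : deg γ ≠ 0 := by omega
    beta_reduce
    rw [if_neg hβ, if_neg hγ]
    have hβ' : β ≠ 0 := fun h0 => hβ (deg_eq_zero.2 h0)
    have hγ' : γ ≠ 0 := fun h0 => hγ (deg_eq_zero.2 h0)
    rcases le_or_gt (deg γ) k₁ with hle | hgt
    · calc _ ≤ A ^ deg β * (ρ ^ 2)⁻¹ ^ deg β * (κ ^ 2 * (D i β * D i γ) * A) := by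
            rw [min_eq_left (hlt.le.trans hle)]
            exact mul_le_mul_of_nonneg_left (hA i β γ hβ' hγ' (hlt.le.trans hle) hle) zero_le
        _ = κ ^ 2 * (D i β * D i γ) * (A ^ (deg β + 1) * (ρ ^ 2)⁻¹ ^ deg β) := by ring
        _ ≤ κ ^ 2 * (D i β * D i γ) * (A ^ min (deg γ) k₁ * (ρ ^ 2)⁻¹ ^ deg γ) := by
            rw [min_eq_left hle]
            gcongr
            exact hlt
    · calc _ ≤ A ^ min (deg β) k₁ * (ρ ^ 2)⁻¹ ^ deg β *
              (κ ^ 2 * (D i β * D i γ) * (ρ ^ 2)⁻¹) :=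
            mul_le_mul_of_nonneg_left (h i β γ ((hk₁ i).trans_lt hgt) hβ' hlt hK) zero_le
        _ = κ ^ 2 * (D i β * D i γ) * (A ^ min (deg β) k₁ * (ρ ^ 2)⁻¹ ^ (deg β + 1)) := by ring
        _ ≤ κ ^ 2 * (D i β * D i γ) * (A ^ min (deg γ) k₁ * (ρ ^ 2)⁻¹ ^ deg γ) := by
            gcongr
            exact hlt

theorem hasDerivWithinAt_sqModulus {w : ℝ → Fin n → ℂ} {w' : Fin n → ℂ} {S : Set ℝ} {t : ℝ}
    (h : HasDerivWithinAt w w' S t) :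
    HasDerivWithinAt (fun s => sqModulus (w s))
      (fun l => ((2 * (conj (w t l) * w' l).re : ℝ) : ℂ)) S t := by
  refine hasDerivWithinAt_pi.2 fun l => ?_
  have h1 := (hasDerivWithinAt_pi.1 h l).norm_sq.ofReal_comp
  rw [Complex.inner, mul_comm (w' l)] at h1
  exact h1

theorem sqModulus_mem_ball {w : Fin n → ℂ} {ρ : ℝ} (hw : ‖w‖ < ρ) :
    sqModulus w ∈ Metric.ball (0 : Fin n → ℂ) (ρ ^ 2) := by
  have hρ : 0 < ρ := (norm_nonneg _).trans_lt hw
  rw [mem_ball_zero_iff, pi_norm_lt_iff (by positivity)]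
  intro l
  rw [sqModulus, Complex.norm_real, Real.norm_of_nonneg (by positivity)]
  have := (norm_le_pi_norm w l).trans_lt hw
  gcongr

theorem continuous_sqModulus : Continuous (sqModulus : (Fin n → ℂ) → Fin n → ℂ) := by
  unfold sqModulus
  fun_prop

/-- Domination by a geometric series of ratio `‖p‖ / ρ²`. The radius `ρ²` is the one reached by
squared moduli of points with `‖w‖ < ρ`. -/
theorem hasMonoSeries_weights {ε : ℕ → ℝ≥0} {M ρ : ℝ≥0} (hρ : 0 < ρ)
    (hε : ∀ k, ε k ≤ M * (ρ ^ 2)⁻¹ ^ k) :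
    HasMonoSeries (n := n) ((ρ : ℝ) ^ 2) (fun p => ∑' β, (ε (deg β) : ℂ) * mono β p)
      fun β => (ε (deg β) : ℂ) := by
  intro p hp
  rw [mem_ball_zero_iff] at hp
  have hρ' : (0 : ℝ) < (ρ : ℝ) ^ 2 := by positivity
  refine (Summable.of_norm_bounded ((summable_pow_deg (t := ‖p‖ / (ρ : ℝ) ^ 2) (by positivity)
    ((div_lt_one hρ').2 hp) n).mul_left (M : ℝ)) fun β => ?_).hasSum
  have h1 : (ε (deg β) : ℝ) ≤ M * ((ρ : ℝ) ^ 2)⁻¹ ^ deg β := by exact_mod_cast hε (deg β)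
  rw [norm_mul, Complex.norm_real, NNReal.norm_eq]
  calc (ε (deg β) : ℝ) * ‖mono β p‖ ≤ M * ((ρ : ℝ) ^ 2)⁻¹ ^ deg β * ‖p‖ ^ deg β := by
        gcongr
        exact norm_mono_le β le_rfl
    _ = _ := by rw [div_eq_mul_inv, mul_pow]; ring

/-- The Lyapunov function, as a function of the squared moduli, is a sum of squares. -/
theorem HasMonoSeries.hasSum_sqModulus {ε : ℕ → ℝ≥0} {U : (Fin n → ℂ) → ℂ} {ρ : ℝ}
    (hU : HasMonoSeries (ρ ^ 2) U fun β => (ε (deg β) : ℂ)) {w : Fin n → ℂ} (hw : ‖w‖ < ρ) :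
    HasSum (fun β => (ε (deg β) : ℝ) * ‖mono β w‖ ^ 2) (U (sqModulus w)).re := by
  refine (Complex.hasSum_re (hU _ (sqModulus_mem_ball hw))).congr_fun fun β => ?_
  rw [mono_sqModulus, Complex.re_ofReal_mul, Complex.ofReal_re]

theorem norm_mulVec_le_of_infNorm_eq_one {A : Matrix (Fin n) (Fin n) ℂ} (hA : infNorm A = 1)
    (z : Fin n → ℂ) : ‖A.mulVec z‖ ≤ ‖z‖ := by
  refine (pi_norm_le_iff_of_nonneg (norm_nonneg z)).2 fun l => ?_
  have h1 : ∑ k, ‖A l k‖₊ ≤ 1 := by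
    rw [← hA]
    exact Finset.le_sup (f := fun i => ∑ j, ‖A i j‖₊) (Finset.mem_univ l)
  have h2 : ∑ k, ‖A l k‖ ≤ 1 := by simpa using NNReal.coe_le_coe.2 h1
  calc ‖A.mulVec z l‖ ≤ ∑ k, ‖A l k‖ * ‖z‖ := by
        rw [Matrix.mulVec, dotProduct]
        refine norm_sum_le_of_le _ fun k _ => ?_
        rw [norm_mul]
        gcongr
        exact norm_le_pi_norm z k
    _ ≤ 1 * ‖z‖ := by rw [← Finset.sum_mul]; gcongr
    _ = ‖z‖ := one_mul _

/-! ### From the Lyapunov function to stability. -/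

/-- A common Lyapunov function with exponential decay along all trajectories gives stability. -/
theorem isGUAS_of_lyapunov {F : Fin m → (Fin n → ℂ) → Fin n → ℂ} {ρ : ℝ} (hρ : 0 < ρ)
    (hF0 : ∀ i, F i 0 = 0) {V : (Fin n → ℂ) → ℝ} {e c : ℝ} (he : 0 < e) (hc : 0 < c)
    (hV0 : V 0 = 0) (hVc : ContinuousAt V 0)
    (hVe : ∀ σ x, IsCommutationLaw σ → IsTrajectory F (polydisk n 1) σ x → x 0 ∈ polydisk n ρ →
      ∀ t, 0 ≤ t → e * ‖x t‖ ^ 2 ≤ Real.exp (-c * t) * V (x 0)) :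
    IsGUAS F (polydisk n 1) 0 (polydisk n ρ) := by
  rw [polydisk_eq_ball hρ] at *
  have hlim : ∀ σ x, IsCommutationLaw σ → IsTrajectory F (polydisk n 1) σ x →
      x 0 ∈ Metric.ball (0 : Fin n → ℂ) ρ → Tendsto x atTop (𝓝 0) := by
    intro σ x hσ hx h0
    have h1 : Tendsto (fun t : ℝ => √(Real.exp (-c * t) * V (x 0) / e)) atTop (𝓝 0) := by
      have h2 : Tendsto (fun t : ℝ => Real.exp (-c * t)) atTop (𝓝 0) :=
        Real.tendsto_exp_atBot.comp (tendsto_id.const_mul_atTop_of_neg (neg_lt_zero.2 hc))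
      have h3 := ((h2.mul_const (V (x 0))).div_const e).sqrt
      simpa using h3
    refine squeeze_zero_norm' ?_ h1
    filter_upwards [eventually_ge_atTop 0] with t ht
    refine Real.le_sqrt_of_sq_le ?_
    rw [le_div_iff₀ he, mul_comm]
    exact hVe σ x hσ hx h0 t ht
  refine ⟨⟨hF0, fun ε hε => ?_⟩, hlim⟩
  have hnear : ∀ᶠ z in 𝓝 (0 : Fin n → ℂ), V z < e * ε ^ 2 :=
    hVc.eventually_lt_const (by rw [hV0]; positivity)
  obtain ⟨r, hr, hball⟩ := Metric.eventually_nhds_iff_ball.1 hnear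
  have hδ : min r ρ / 2 < min r ρ := half_lt_self (lt_min hr hρ)
  have hmem : ∀ z : Fin n → ℂ, ‖z - 0‖ ≤ min r ρ / 2 → z ∈ Metric.ball (0 : Fin n → ℂ) r ∧
      z ∈ Metric.ball (0 : Fin n → ℂ) ρ := fun z hz => by
    rw [sub_zero] at hz
    exact ⟨mem_ball_zero_iff.2 ((hz.trans_lt hδ).trans_le (min_le_left _ _)),
      mem_ball_zero_iff.2 ((hz.trans_lt hδ).trans_le (min_le_right _ _))⟩
  refine ⟨min r ρ / 2, half_pos (lt_min hr hρ), fun σ x hσ hx h0 t ht => ?_,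
    fun σ x hσ hx h0 => hlim σ x hσ hx (hmem _ h0).2⟩
  have h1 := hVe σ x hσ hx (hmem _ h0).2 t ht.le
  have h2 := hball _ (hmem _ h0).1
  have h3 : 0 ≤ V (x 0) := by
    have := hVe σ x hσ hx (hmem _ h0).2 0 le_rfl
    simp only [mul_zero, Real.exp_zero, one_mul] at this
    exact (by positivity : 0 ≤ e * ‖x 0‖ ^ 2).trans this
  have h4 : Real.exp (-c * t) ≤ 1 := Real.exp_le_one_iff.2 (by nlinarith)
  rw [sub_zero]
  refine le_of_sq_le_sq ?_ hε.le
  have h5 := mul_le_of_le_one_left h3 h4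
  exact le_of_mul_le_mul_left (by linarith) he

theorem mainTheorem3 {n m : ℕ}
    (F : Fin m → (Fin n → ℂ) → (Fin n → ℂ))
    (φ : Fin m → ℝ → (Fin n → ℂ) → (Fin n → ℂ))
    (hF : ∀ i l, HasSummableTaylor (fun z => F i z l))
    (hφ : ∀ i, IsHolomorphicFlow (F i) (polydisk n 1) (φ i))
    (hhyp : ∀ i, IsHyperbolicStableAtZero (F i))
    (hgas : ∀ i, IsGloballyAsymptoticallyStable (φ i) (polydisk n 1) 0)
    (hsolv : HasSolvableLieSpan (Set.range fun i => jacobian (F i) 0))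
    (P : Matrix (Fin n) (Fin n) ℂ) (hP : IsUnit P.det) (hPnorm : infNorm P⁻¹ = 1)
    (htri : ∀ i, (P⁻¹ * jacobian (F i) 0 * P).BlockTriangular id)
    (ρ : ℝ) (hρ0 : 0 < ρ) (hρ1 : ρ ≤ 1)
    (hinv : ∀ i, IsForwardInvariant (φ i) (polydisk n ρ))
    (ξ κ : ℝ) (hξ0 : 0 < ξ) (hξ1 : ξ < 1) (hκ0 : 0 < κ) (hκ1 : κ < 1) (hξκ : ξ + κ < 1)
    (hdiag₁ : ∀ i, ∀ q r : Fin n, q < r →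
      ‖jacobian (changeCoord P (F i)) 0 q r‖ ^ 2 <
        (2 * ξ / ((n : ℝ) ^ 2 - n)) ^ 2 *
          |(jacobian (changeCoord P (F i)) 0 r r).re| *
          |(jacobian (changeCoord P (F i)) 0 q q).re|)
    (hdiag₂ : ∀ i, ∀ q r : Fin n, q < r →
      ‖jacobian (changeCoord P (F i)) 0 q r‖ <
        2 * ξ / ((n : ℝ) ^ 2 - n) * |(jacobian (changeCoord P (F i)) 0 q q).re|)
    (hlim : ∀ i, koopmanLimsup κ (changeCoord P (F i)) < ENNReal.ofReal (1 / ρ ^ 2)) :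
    IsGUAS F (polydisk n 1) 0 (polydisk n ρ) := by
  lift ρ to ℝ≥0 using hρ0.le
  lift ξ to ℝ≥0 using hξ0.le
  lift κ to ℝ≥0 using hκ0.le
  have hρ : 0 < ρ := by exact_mod_cast hρ0
  have hκ : 0 < κ := by exact_mod_cast hκ0
  choose α hα1 hα2 using hF
  have hFs : ∀ i l, HasMonoSeries 1 (fun z => F i z l) (α i l) := fun i l z hz =>
    hα2 i l z (by rwa [polydisk_eq_ball one_pos])
  have hFd : ∀ i, ∀ z ∈ Metric.ball (0 : Fin n → ℂ) 1, DifferentiableAt ℂ (F i) z :=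
    fun i z hz => differentiableAt_pi.2 fun l => (hFs i l).differentiableAt hz
  have hlim' : ∀ i, koopmanLimsup κ (changeCoord P (F i)) < (((ρ ^ 2)⁻¹ : ℝ≥0) : ℝ≥0∞) :=
    fun i => by
      refine (hlim i).trans_eq ?_
      rw [← ENNReal.ofReal_coe_nnreal]
      simp
  choose b d R C k₀ hb hbs hbG hbJ hT hd0 hd hR hC hk₀ using fun i =>
    exists_koopman_data (fun l => ⟨α i l, hα1 i l, hα2 i l⟩) (hFd i) (hhyp i) hP (htri i) hκ
      (hlim' i)
  obtain ⟨ε, M, hε0, hεpos, hεM, hε⟩ := exists_weights hκ hρ (by exact_mod_cast hρ1)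
    (D := fun i => diagWeight (d i)) (fun i β => diagWeight_pos (hd0 i))
    (K := fun i β γ => koopmanCoeff (b i) β γ ≠ 0) hk₀
  have hU := hasMonoSeries_weights (n := n) hρ hεM
  set U : (Fin n → ℂ) → ℂ := fun p => ∑' β, (ε (deg β) : ℂ) * mono β p
  obtain ⟨c₀, hc₀, hc₀d⟩ := exists_pos_le_of_finite
    (f := fun p : Fin m × Fin n => (d p.1 p.2 : ℝ)) fun p => by exact_mod_cast hd0 p.1 p.2
  -- the constant of the same-degree entries
  have hn : (0 : ℝ) ≤ (n : ℝ) ^ 2 - n := by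
    have : n ≤ n ^ 2 := Nat.le_self_pow two_ne_zero n
    have : (n : ℝ) ≤ (n : ℝ) ^ 2 := by exact_mod_cast this
    linarith
  obtain ⟨θ, hθ⟩ : ∃ θ : ℝ≥0, (θ : ℝ) = 2 * ξ / ((n : ℝ) ^ 2 - n) :=
    ⟨⟨2 * ξ / ((n : ℝ) ^ 2 - n), by positivity⟩, rfl⟩
  -- There are `(n² - n) / 2` pairs, each charged `θ`. For `n = 1` the denominator is zero, so `θ =
  -- 0` by the division convention, and there are no pairs.
  have hθξ : (upperPairs n).card * θ ≤ ξ := by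
    rw [← NNReal.coe_le_coe, NNReal.coe_mul, hθ, NNReal.coe_natCast]
    have h1 : 2 * ((upperPairs n).card : ℝ) + n = (n : ℝ) ^ 2 := by
      exact_mod_cast two_mul_card_upperPairs n
    rw [show ((upperPairs n).card : ℝ) = ((n : ℝ) ^ 2 - n) / 2 by linarith]
    generalize (n : ℝ) ^ 2 - n = N at hn
    rcases hn.eq_or_lt with h0 | h0
    · simp [← h0]
    · apply le_of_eq
      field_simp
  have habs : ∀ i l, |(jacobian (changeCoord P (F i)) 0 l l).re| = d i l := fun i l => by
    rw [hd, abs_neg, NNReal.abs_eq]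
  have hT1 : ∀ i q r, q < r →
      ‖jacobian (changeCoord P (F i)) 0 q r‖₊ ^ 2 ≤ θ ^ 2 * (d i q * d i r) := fun i q r h => by
    have := (hdiag₁ i q r h).le
    rw [habs, habs, ← hθ] at this
    rw [← NNReal.coe_le_coe]
    push_cast
    linarith
  have hT2 : ∀ i q r, q < r →
      ‖jacobian (changeCoord P (F i)) 0 q r‖₊ ≤ θ * d i q := fun i q r h => by
    have := (hdiag₂ i q r h).le
    rw [habs, ← hθ] at this
    exact_mod_cast this
  -- linear coordinates
  set A : (Fin n → ℂ) →L[ℂ] (Fin n → ℂ) := (Matrix.toLin' P⁻¹).toContinuousLinearMap with hA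
  set B : (Fin n → ℂ) →L[ℂ] (Fin n → ℂ) := (Matrix.toLin' P).toContinuousLinearMap with hB
  have hBA : ∀ z, B (A z) = z := fun z => by
    simp [hA, hB, Matrix.mulVec_mulVec, Matrix.mul_nonsing_inv P hP]
  have hAn : ∀ z, ‖A z‖ ≤ ‖z‖ := norm_mulVec_le_of_infNorm_eq_one hPnorm
  have hVsum : ∀ {w : Fin n → ℂ}, ‖w‖ < ρ → _ := fun hw => hU.hasSum_sqModulus hw
  -- The degree-one terms `ε₁ |w_l|²` alone dominate the squared maximum norm.
  have hVnorm : ∀ {w : Fin n → ℂ}, ‖w‖ < ρ → (ε 1 : ℝ) * ‖w‖ ^ 2 ≤ (U (sqModulus w)).re := by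
    intro w hw
    have hnn : 0 ≤ (U (sqModulus w)).re := (hVsum hw).nonneg fun β => by positivity
    have h1 : ‖w‖ ≤ √((U (sqModulus w)).re / ε 1) := by
      refine (pi_norm_le_iff_of_nonneg (Real.sqrt_nonneg _)).2 fun l => Real.le_sqrt_of_sq_le ?_
      rw [le_div_iff₀ (by exact_mod_cast hεpos 1 one_pos), mul_comm]
      have := le_hasSum (hVsum hw) (Pi.single l 1) fun β _ => by positivity
      simpa using this
    have h2 := (Real.le_sqrt (norm_nonneg _) (by positivity)).1 h1
    rwa [le_div_iff₀ (by exact_mod_cast hεpos 1 one_pos), mul_comm] at h2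
  -- In the rate `c`, the factor `2(1 - ξ - κ)` comes from `lyapunov_deriv_le`, and `c₀` bounds all
  -- diagonal weights of nonconstant monomials from below. In `e`, the factor `‖B‖ + 1` passes from
  -- `‖w‖` to `‖z‖` and cannot vanish.
  refine isGUAS_of_lyapunov hρ0 (fun i => (hhyp i).1) (V := fun z => (U (sqModulus (A z))).re)
    (e := ε 1 / (‖B‖ + 1) ^ 2) (c := 2 * (1 - (ξ + κ)) * c₀)
    (div_pos (by exact_mod_cast hεpos 1 one_pos) (by positivity))
    (mul_pos (by linarith) hc₀) ?_ ?_ ?_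
  · have h0 : sqModulus (0 : Fin n → ℂ) = 0 := by
      funext l
      simp [sqModulus]
    simp only [map_zero, h0]
    rw [hU.apply_zero (by positivity)]
    simp [deg, hε0]
  · have h0 : sqModulus (A 0) ∈ Metric.ball (0 : Fin n → ℂ) ((ρ : ℝ) ^ 2) := by
      apply sqModulus_mem_ball
      simpa using hρ0
    have h1 := (hU.differentiableAt h0).continuousAt
    have h2 : ContinuousAt (fun z => sqModulus (A z)) 0 :=
      (continuous_sqModulus.comp A.continuous).continuousAt
    exact Complex.continuous_re.continuousAt.comp (ContinuousAt.comp (g := U) h1 h2)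
  · intro σ x hσ hx h0 t ht
    rw [polydisk_eq_ball one_pos] at hx hφ
    rw [polydisk_eq_ball hρ0] at hinv h0
    have hin : ∀ s, 0 ≤ s → ‖x s‖ < ρ := fun s hs => mem_ball_zero_iff.1
      (hx.mem_of_isForwardInvariant hFs hσ hφ Metric.isOpen_ball hinv h0 hs)
    have hwin : ∀ s, 0 ≤ s → ‖A (x s)‖ < ρ := fun s hs => (hAn _).trans_lt (hin s hs)
    have hdecay : (U (sqModulus (A (x t)))).re ≤
        Real.exp (-(2 * (1 - (ξ + κ)) * c₀) * t) * (U (sqModulus (A (x 0)))).re := by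
      refine le_exp_mul_of_hasDerivWithinAt (V := fun s => (U (sqModulus (A (x s)))).re)
        (fun s hs => ?_) (fun s hs => ?_) ht
      · have h1 := (hU.differentiableAt (sqModulus_mem_ball (hwin s hs))).continuousAt
        have h2 : ContinuousWithinAt (fun s => sqModulus (A (x s))) (Ici 0) s :=
          (continuous_sqModulus.comp A.continuous).continuousAt.comp_continuousWithinAt
            (hx.continuousOn s hs)
        exact Complex.continuous_re.continuousAt.comp_continuousWithinAt
          (ContinuousAt.comp_continuousWithinAt (g := U) h1 h2)
      -- Just after `s` a single field is active, which gives a right derivative even at a switching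
      -- time.
      · obtain ⟨s', hs', i, hi⟩ := hσ.exists_right hs
        have h1 := hx.hasDerivWithinAt_Ici (fun i => HasMonoSeries.continuousOn (hFs i)) hs hs' hi
        have h2 : HasDerivWithinAt (fun s => A (x s)) (A (F i (x s))) (Ici s) s :=
          (A.restrictScalars ℝ).hasFDerivAt.comp_hasDerivWithinAt s h1
        have h3 : A (F i (x s)) = fun l => ∑' η, b i l η * mono η (A (x s)) := by
          have hw1 : ‖A (x s)‖ < 1 := (hwin s hs).trans_le hρ1
          have hw2 : ‖B (A (x s))‖ < 1 := by
            rw [hBA]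
            exact (hin s hs).trans_le hρ1
          rw [← hbG i (A (x s)) hw1 hw2]
          exact congrArg (fun z => A (F i z)) (hBA (x s)).symm
        rw [h3] at h2
        obtain ⟨f', hf1, hf2⟩ := hU.hasFDerivAt_of_mem (sqModulus_mem_ball (hwin s hs))
        have h4 := (hf1.restrictScalars ℝ).comp_hasDerivWithinAt s (hasDerivWithinAt_sqModulus h2)
        have h5 := Complex.reCLM.hasFDerivAt.comp_hasDerivWithinAt s h4
        refine ⟨_, h5, ?_⟩
        obtain ⟨Y, hY, hle⟩ := lyapunov_deriv_le (hb i) (hbs i) (hbJ i) (hT i) (hd i) hθξ (hT1 i)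
          (hT2 i) (hR i) (hC i) (hε i)
          (mem_ball_zero_iff.2 ((hwin s hs).trans_le hρ1)) hf2
        refine hle.trans ?_
        -- The comparison is termwise: nonconstant monomials have diagonal weight at least `c₀`, and
        -- the constant one has `ε 0 = 0`.
        have hVY : c₀ * (U (sqModulus (A (x s)))).re ≤ Y := by
          refine hasSum_le (fun β => ?_) ((hVsum (hwin s hs)).mul_left c₀) (NNReal.hasSum_coe.2 hY)
          by_cases hβ : β = 0
          · simp [hβ, deg, hε0]
          · obtain ⟨l, hl⟩ := Function.ne_iff.1 hβ
            have hD : c₀ ≤ diagWeight (d i) β := by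
              have h6 : (1 : ℝ≥0) ≤ β l := by exact_mod_cast Nat.one_le_iff_ne_zero.2 hl
              have h7 : d i l ≤ diagWeight (d i) β :=
                (le_mul_of_one_le_left zero_le h6).trans (mul_le_diagWeight (d i) β l)
              exact (hc₀d (i, l)).trans (by exact_mod_cast h7)
            push_cast
            have h8 : (0 : ℝ) ≤ ε (deg β) * ‖mono β (A (x s))‖ ^ 2 := by positivity
            calc c₀ * (ε (deg β) * ‖mono β (A (x s))‖ ^ 2)
                ≤ diagWeight (d i) β * (ε (deg β) * ‖mono β (A (x s))‖ ^ 2) := by gcongr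
              _ = _ := by ring
        have := mul_le_mul_of_nonneg_left hVY (by linarith : (0 : ℝ) ≤ 2 * (1 - (ξ + κ)))
        linarith
    have hxA : ‖x t‖ ≤ (‖B‖ + 1) * ‖A (x t)‖ := by
      calc ‖x t‖ = ‖B (A (x t))‖ := by rw [hBA]
        _ ≤ ‖B‖ * ‖A (x t)‖ := B.le_opNorm _
        _ ≤ _ := by gcongr; linarith
    refine le_trans ?_ ((hVnorm (hwin t ht)).trans hdecay)
    calc ε 1 / (‖B‖ + 1) ^ 2 * ‖x t‖ ^ 2
        ≤ ε 1 / (‖B‖ + 1) ^ 2 * ((‖B‖ + 1) * ‖A (x t)‖) ^ 2 := by gcongr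
      _ = ε 1 * ‖A (x t)‖ ^ 2 := by
          have : ‖B‖ + 1 ≠ 0 := by positivity
          field_simp
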